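/- Let $\alpha>0$, $\alpha\neq 1$, and let $U^\alpha=\{(z_1,z_2)\in\mathbb C^2:|z_1|^{2/\alpha}+|z_2|^2<1\}$ with Lebesgue measure $\sigma$. Let $A^2(U^\alpha)$ be the Bergman space of square-integrable holomorphic functions on $U^\alpha$ with $\langle f,g\rangle=\int_{U^\alpha}f\bar g\,d\sigma$, let $K_z\in A^2(U^\alpha)$ be the reproducing (Bergman) kernel at $z\in U^\alpha$, that is, $f(z)=\langle f,K_z\rangle$ for all $f\in A^2(U^\alpha)$, and let $k_z=K_z/\|K_z\|$. For $a,b$ in the unit disc and $w\in U^\alpha$ put $$\varphi_{b}(w)=\left(w_1\Big(\tfrac{\sqrt{1-|b|^2}}{1-\bar b w_2}\Big)^{\alpha},\ \tfrac{b-w_2}{1-\bar b w_2}\right),$$ $$\phi_a(w)=\left(m,\ w_2\,\tfrac{\sqrt{1-|a|^2}}{1-\bar a w_1}\sqrt{\tfrac{(1-|w_1|^2)(1-|m|^{2/\alpha})}{(1-|w_1|^{2/\alpha})(1-|m|^2)}}\right),\qquad m=\tfrac{a-w_1}{1-\bar a w_1},$$ where the power is the principal one. For $z\in U^\alpha$,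 $w\in U^\alpha$ and a function $g$ on $U^\alpha$ let $U_zg(w)=g(\varphi_{z_2}(w))\,J\varphi_{z_2}(w)$ and $V_ag(w)=g(\phi_a(w))\,J\phi_a(w)$, where $JF=\det(\partial F_i/\partial w_j)$ is the holomorphic Jacobian determinant ($\partial/\partial w_j$ being Wirtinger derivatives), and let $f_\alpha(z)=z_1/(1-|z_2|^2)^{\alpha/2}$. Let $T$ and $T^*$ be linear operators from the linear span of $\{k_z:z\in U^\alpha\}$ into $A^2(U^\alpha)$ such that $\langle Tk_z,k_w\rangle=\langle k_z,T^*k_w\rangle$ for all $z,w\in U^\alpha$. If for some $p$ with $4<p\le\infty$ $$\sup_{z\in U^\alpha}\|V_{f_\alpha(z)}U_zTk_z\|_{L^p(U^\alpha)}<\infty\quad\text{and}\quad\sup_{z\in U^\alpha}\|V_{f_\alpha(z)}U_zT^*k_z\|_{L^p(U^\alpha)}<\infty,$$ then $T$ extends to a bounded linear operator on $A^2(U^\alpha)$. -/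

import Mathlib

namespace BergmanAux

open MeasureTheory Filter Topology Metric
open scoped ENNReal

theorem enorm_mul_le_lintegral_circle {g : ℂ → ℂ} {c : ℂ} {R s : ℝ}
    (hg : DifferentiableOn ℂ g (ball c R)) (hs : 0 < s) (hsR : s < R) :
    ‖g c‖ₑ * ENNReal.ofReal (2 * Real.pi) ≤
      ∫⁻ θ in Set.Ioo (-Real.pi) Real.pi, ‖g (circleMap c s θ)‖ₑ := by
  have h1 : DiffContOnCl ℂ g (ball c |s|) := by
    rw [abs_of_pos hs]
    apply DifferentiableOn.diffContOnCl
    rw [closure_ball _ hs.ne']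
    exact hg.mono (closedBall_subset_ball hsR)
  have h2 := h1.circleAverage
  rw [Real.circleAverage_def] at h2
  have h3 : ∫ θ in (0 : ℝ)..2 * Real.pi, g (circleMap c s θ) =
      ∫ θ in (-Real.pi)..Real.pi, g (circleMap c s θ) := by
    have hp : Function.Periodic (fun θ => g (circleMap c s θ)) (2 * Real.pi) :=
      fun θ => by simp only [periodic_circleMap c s θ]
    have := hp.intervalIntegral_add_eq 0 (-Real.pi)
    rw [zero_add] at this
    rw [this]
    congr 1
    ring
  rw [h3, intervalIntegral.integral_of_le (by linarith [Real.pi_pos]),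
    integral_Ioc_eq_integral_Ioo] at h2
  have h4 : ∫ θ in Set.Ioo (-Real.pi) Real.pi, g (circleMap c s θ) = (2 * Real.pi) • g c := by
    rw [← h2, smul_smul, mul_inv_cancel₀ (by positivity), one_smul]
  have h5 := enorm_integral_le_lintegral_enorm
    (μ := volume.restrict (Set.Ioo (-Real.pi) Real.pi)) (fun θ => g (circleMap c s θ))
  rw [h4, enorm_smul, mul_comm] at h5
  convert h5 using 2
  rw [Real.enorm_eq_ofReal (by positivity)]

theorem enorm_mul_le_lintegral_ball {g : ℂ → ℂ} {c : ℂ} {R : ℝ} (hR : 0 < R)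
    (hg : DifferentiableOn ℂ g (ball c R)) :
    ‖g c‖ₑ * ENNReal.ofReal (R ^ 2) ≤ ∫⁻ x in ball c R, ‖g x‖ₑ := by
  set h : ℂ → ℝ≥0∞ := (ball c R).indicator (fun x => ‖g x‖ₑ) with hh
  have hm : Measurable h := by
    classical
    have := ContinuousOn.measurable_piecewise (s := ball c R) (f := fun x => ‖g x‖ₑ)
      (g := fun _ => (0 : ℝ≥0∞)) hg.continuousOn.enorm continuousOn_const measurableSet_ball
    have e : h = (ball c R).piecewise (fun x => ‖g x‖ₑ) (fun _ => 0) :=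
      (Set.piecewise_eq_indicator (s := ball c R) (f := fun x => ‖g x‖ₑ)).symm
    rw [e]
    exact this
  have e1 : ∫⁻ x in ball c R, ‖g x‖ₑ = ∫⁻ x, h (c + x) := by
    rw [lintegral_add_left_eq_self h c, hh, lintegral_indicator measurableSet_ball]
  have hsymm : ∀ p : ℝ × ℝ, c + Complex.polarCoord.symm p = circleMap c p.1 p.2 := by
    intro p
    rw [Complex.polarCoord_symm_apply, circleMap, Complex.exp_mul_I]
    push_cast
    rfl
  rw [e1, ← Complex.lintegral_comp_polarCoord_symm, polarCoord_target,
    Measure.volume_eq_prod, ← Measure.prod_restrict, lintegral_prod]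
  swap
  · apply Measurable.aemeasurable
    simp_rw [hsymm, smul_eq_mul]
    have : Measurable fun p : ℝ × ℝ => circleMap c p.1 p.2 := by
      unfold circleMap; fun_prop
    fun_prop
  simp_rw [hsymm, smul_eq_mul]
  calc ‖g c‖ₑ * ENNReal.ofReal (R ^ 2)
      ≤ ∫⁻ s in Set.Ioo 0 R, ENNReal.ofReal s * (‖g c‖ₑ * ENNReal.ofReal (2 * Real.pi)) := by
        rw [lintegral_mul_const _ (by fun_prop)]
        have : ∫⁻ s in Set.Ioo 0 R, ENNReal.ofReal s = ENNReal.ofReal (R ^ 2 / 2) := by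
          rw [← ofReal_integral_eq_lintegral_ofReal, ← integral_Ioc_eq_integral_Ioo,
            ← intervalIntegral.integral_of_le hR.le, integral_id]
          · congr 1; ring
          · exact (continuous_id.integrableOn_Icc (a := 0) (b := R)).mono_set
              Set.Ioo_subset_Icc_self
          · filter_upwards [ae_restrict_mem measurableSet_Ioo] with s hs using hs.1.le
        rw [this, mul_comm (ENNReal.ofReal (R ^ 2 / 2)), mul_assoc,
          ← ENNReal.ofReal_mul (by positivity)]
        gcongr
        nlinarith [Real.pi_gt_three, sq_nonneg R]
    _ ≤ ∫⁻ s in Set.Ioo 0 R, ENNReal.ofReal s *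
          ∫⁻ θ in Set.Ioo (-Real.pi) Real.pi, h (circleMap c s θ) := by
        apply setLIntegral_mono' measurableSet_Ioo
        intro s hs
        gcongr
        have : ∀ θ, h (circleMap c s θ) = ‖g (circleMap c s θ)‖ₑ := by
          intro θ
          rw [hh, Set.indicator_of_mem]
          rw [mem_ball, dist_eq_norm]
          simpa [circleMap, abs_of_pos hs.1] using hs.2
        simp_rw [this]
        exact enorm_mul_le_lintegral_circle hg hs.1 hs.2
    _ = ∫⁻ s in Set.Ioo 0 R, ∫⁻ θ in Set.Ioo (-Real.pi) Real.pi,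
          ENNReal.ofReal s * h (circleMap c s θ) := by
        congr 1 with s
        rw [lintegral_const_mul]
        have : Measurable fun θ : ℝ => circleMap c s θ := by unfold circleMap; fun_prop
        fun_prop
    _ ≤ _ := lintegral_mono_set Set.Ioo_subset_Ioi_self

theorem enorm_mul_le_lintegral_ball_prod {F : ℂ × ℂ → ℂ} {z : ℂ × ℂ} {R : ℝ} (hR : 0 < R)
    (hF : DifferentiableOn ℂ F (ball z R)) :
    ‖F z‖ₑ * ENNReal.ofReal (R ^ 2) * ENNReal.ofReal (R ^ 2) ≤ ∫⁻ x in ball z R, ‖F x‖ₑ := by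
  obtain ⟨z1, z2⟩ := z
  have hFm : AEMeasurable (fun x => ‖F x‖ₑ)
      ((volume.restrict (ball z1 R)).prod (volume.restrict (ball z2 R))) := by
    rw [Measure.prod_restrict, ← Measure.volume_eq_prod, ball_prod_same]
    exact hF.continuousOn.enorm.aemeasurable measurableSet_ball
  rw [← ball_prod_same] at hF ⊢
  rw [Measure.volume_eq_prod, ← Measure.prod_restrict, lintegral_prod _ hFm]
  have h1 : DifferentiableOn ℂ (fun t => F (t, z2)) (ball z1 R) := by
    apply hF.comp (by fun_prop)
    intro t ht
    exact ⟨ht, mem_ball_self hR⟩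
  replace h1 := enorm_mul_le_lintegral_ball hR h1
  calc _ ≤ (∫⁻ x in ball z1 R, ‖F (x, z2)‖ₑ) * ENNReal.ofReal (R ^ 2) := by gcongr
    _ = ∫⁻ x in ball z1 R, ‖F (x, z2)‖ₑ * ENNReal.ofReal (R ^ 2) := by
        rw [lintegral_mul_const' _ _ ENNReal.ofReal_ne_top]
    _ ≤ _ := by
        apply setLIntegral_mono' measurableSet_ball
        intro x hx
        have h2 : DifferentiableOn ℂ (fun t => F (x, t)) (ball z2 R) := by
          apply hF.comp (by fun_prop)
          intro t ht
          exact ⟨hx, ht⟩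
        exact enorm_mul_le_lintegral_ball hR h2

theorem exists_norm_le_eLpNorm {Ω : Set (ℂ × ℂ)} {z : ℂ × ℂ} {R : ℝ} (hR : 0 < R)
    (hz : ball z (2 * R) ⊆ Ω) :
    ∃ C : ℝ, 0 ≤ C ∧ ∀ F : ℂ × ℂ → ℂ, DifferentiableOn ℂ F Ω → ∀ w ∈ ball z R,
      ‖F w‖ₑ ≤ ENNReal.ofReal C * eLpNorm F 2 (volume.restrict Ω) := by
  set A : ℝ≥0∞ := ENNReal.ofReal (R ^ 2) with hA
  have hA0 : A ≠ 0 := by simp only [hA, ne_eq, ENNReal.ofReal_eq_zero, not_le]; positivity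
  have hAt : A ≠ ⊤ := ENNReal.ofReal_ne_top
  set B : ℝ≥0∞ := (volume (ball z (2 * R))) ^ (1 / (1 : ℝ≥0∞).toReal - 1 / (2 : ℝ≥0∞).toReal)
  have hBt : B ≠ ⊤ := by
    apply ENNReal.rpow_ne_top_of_nonneg
    · norm_num
    · exact measure_ball_lt_top.ne
  refine ⟨(B / (A * A)).toReal, ENNReal.toReal_nonneg, fun F hF w hw => ?_⟩
  rw [ENNReal.ofReal_toReal (ENNReal.div_ne_top hBt (mul_ne_zero hA0 hA0))]
  have hsub : ball w R ⊆ ball z (2 * R) := by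
    apply ball_subset_ball'
    rw [mem_ball] at hw
    linarith
  have h1 := enorm_mul_le_lintegral_ball_prod hR (hF.mono (hsub.trans hz))
  have h2 : ∫⁻ x in ball w R, ‖F x‖ₑ ≤ ∫⁻ x in ball z (2 * R), ‖F x‖ₑ := lintegral_mono_set hsub
  have h3 : ∫⁻ x in ball z (2 * R), ‖F x‖ₑ
      ≤ eLpNorm F 2 (volume.restrict (ball z (2 * R))) * B := by
    rw [← eLpNorm_one_eq_lintegral_enorm]
    have := eLpNorm_le_eLpNorm_mul_rpow_measure_univ (μ := volume.restrict (ball z (2 * R)))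
      (p := 1) (q := 2) (f := F) (by norm_num)
      ((hF.mono hz).continuousOn.aestronglyMeasurable measurableSet_ball)
    rwa [Measure.restrict_apply_univ] at this
  have h4 : eLpNorm F 2 (volume.restrict (ball z (2 * R))) ≤ eLpNorm F 2 (volume.restrict Ω) :=
    eLpNorm_mono_measure _ (Measure.restrict_mono hz le_rfl)
  have h5 : ‖F w‖ₑ * (A * A) ≤ eLpNorm F 2 (volume.restrict Ω) * B := by
    rw [← mul_assoc]
    exact h1.trans (h2.trans (h3.trans (by gcongr)))
  rw [mul_comm, ← mul_div_assoc]
  rwa [ENNReal.le_div_iff_mul_le (Or.inl (mul_ne_zero hA0 hA0))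
    (Or.inl (ENNReal.mul_ne_top hAt hAt))]

theorem norm_fderiv_le_of_ball {F : ℂ × ℂ → ℂ} {w : ℂ × ℂ} {ρ M : ℝ} (hρ : 0 < ρ)
    (hF : DifferentiableOn ℂ F (ball w (2 * ρ))) (hM : ∀ x ∈ ball w (2 * ρ), ‖F x‖ ≤ M) :
    ‖fderiv ℂ F w‖ ≤ M / ρ := by
  have hw : w ∈ ball w (2 * ρ) := mem_ball_self (by positivity)
  have hM0 : 0 ≤ M := (norm_nonneg _).trans (hM w hw)
  refine ContinuousLinearMap.opNorm_le_bound _ (by positivity) fun v => ?_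
  rcases eq_or_ne v 0 with rfl | hv
  · simp
  have hv' : 0 < ‖v‖ := norm_pos_iff.mpr hv
  have hmaps : ∀ t ∈ closedBall (0 : ℂ) (ρ / ‖v‖), w + t • v ∈ ball w (2 * ρ) := by
    intro t ht
    rw [mem_closedBall_zero_iff, le_div_iff₀ hv'] at ht
    rw [mem_ball, dist_eq_norm, add_sub_cancel_left, norm_smul]
    linarith
  have hd : HasDerivAt (fun t : ℂ => F (w + t • v)) (fderiv ℂ F w v) 0 := by
    have h1 : HasFDerivAt F (fderiv ℂ F w) (w + (0 : ℂ) • v) := by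
      simpa using (hF.differentiableAt (isOpen_ball.mem_nhds hw)).hasFDerivAt
    have h2 : HasDerivAt (fun t : ℂ => w + t • v) v 0 := by
      simpa using ((hasDerivAt_id (0 : ℂ)).smul_const v).const_add w
    exact h1.comp_hasDerivAt 0 h2
  have hdc : DiffContOnCl ℂ (fun t : ℂ => F (w + t • v)) (ball 0 (ρ / ‖v‖)) := by
    apply DifferentiableOn.diffContOnCl
    rw [closure_ball _ (by positivity)]
    exact hF.comp (by fun_prop) hmaps
  have := Complex.norm_deriv_le_of_forall_mem_sphere_norm_le (by positivity) hdc
    (fun t ht => hM _ (hmaps t (sphere_subset_closedBall ht)))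
  rw [hd.deriv] at this
  refine this.trans (le_of_eq ?_)
  field_simp

end BergmanAux

section BergmanSpace

open MeasureTheory Filter Topology Metric TopologicalSpace BergmanAux

/-- The Bergman space `A²(Ω)`: the square-integrable functions on `Ω` (with respect to Lebesgue
measure) that are holomorphic on `Ω`, as a subspace of `L²(Ω)`. -/
def bergmanSpace (Ω : Opens (ℂ × ℂ)) :
    Submodule ℂ (Lp ℂ 2 ((volume : Measure (ℂ × ℂ)).restrict Ω)) where
  carrier := {f | ∃ F : ℂ × ℂ → ℂ, DifferentiableOn ℂ F Ω ∧ f =ᵐ[volume.restrict Ω] F}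
  add_mem' := by
    rintro f g ⟨F, hF, hfF⟩ ⟨G, hG, hgG⟩
    refine ⟨F + G, hF.add hG, ?_⟩
    filter_upwards [Lp.coeFn_add f g, hfF, hgG] with x h1 h2 h3
    rw [h1, Pi.add_apply, Pi.add_apply, h2, h3]
  zero_mem' := by
    refine ⟨fun _ => 0, differentiableOn_const 0, ?_⟩
    filter_upwards [Lp.coeFn_zero ℂ 2 ((volume : Measure (ℂ × ℂ)).restrict Ω)] with x h1
    rw [h1, Pi.zero_apply]
  smul_mem' := by
    rintro c f ⟨F, hF, hfF⟩
    refine ⟨c • F, hF.const_smul c, ?_⟩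
    filter_upwards [Lp.coeFn_smul c f, hfF] with x h1 h2
    rw [h1, Pi.smul_apply, Pi.smul_apply, h2]

namespace bergmanSpace

variable {Ω : Opens (ℂ × ℂ)}

/-- An element of `A²(Ω)` as a holomorphic function on `Ω` (its values on `Ω` are uniquely
determined, its values off `Ω` are irrelevant). -/
noncomputable def toFun (f : bergmanSpace Ω) : ℂ × ℂ → ℂ := f.2.choose

theorem differentiableOn_toFun (f : bergmanSpace Ω) : DifferentiableOn ℂ (toFun f) Ω :=
  f.2.choose_spec.1

theorem coeFn_ae_eq_toFun (f : bergmanSpace Ω) :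
    (f : Lp ℂ 2 ((volume : Measure (ℂ × ℂ)).restrict Ω)) =ᵐ[volume.restrict Ω] toFun f :=
  f.2.choose_spec.2

theorem toFun_eqOn {f : bergmanSpace Ω} {F : ℂ × ℂ → ℂ} (hF : DifferentiableOn ℂ F Ω)
    (h : (f : Lp ℂ 2 ((volume : Measure (ℂ × ℂ)).restrict Ω)) =ᵐ[volume.restrict Ω] F) :
    Set.EqOn (toFun f) F Ω :=
  Measure.eqOn_open_of_ae_eq ((coeFn_ae_eq_toFun f).symm.trans h) Ω.isOpen
    (differentiableOn_toFun f).continuousOn hF.continuousOn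

theorem toFun_add (f g : bergmanSpace Ω) : Set.EqOn (toFun (f + g)) (toFun f + toFun g) Ω :=
  toFun_eqOn ((differentiableOn_toFun f).add (differentiableOn_toFun g))
    ((Lp.coeFn_add _ _).trans ((coeFn_ae_eq_toFun f).add (coeFn_ae_eq_toFun g)))

theorem toFun_smul (c : ℂ) (f : bergmanSpace Ω) : Set.EqOn (toFun (c • f)) (c • toFun f) Ω :=
  toFun_eqOn ((differentiableOn_toFun f).const_smul c)
    ((Lp.coeFn_smul _ _).trans ((coeFn_ae_eq_toFun f).const_smul c))

theorem toFun_sub (f g : bergmanSpace Ω) : Set.EqOn (toFun (f - g)) (toFun f - toFun g) Ω :=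
  toFun_eqOn ((differentiableOn_toFun f).sub (differentiableOn_toFun g))
    ((Lp.coeFn_sub _ _).trans ((coeFn_ae_eq_toFun f).sub (coeFn_ae_eq_toFun g)))

theorem exists_norm_toFun_le {z : ℂ × ℂ} {R : ℝ} (hR : 0 < R)
    (hz : ball z (2 * R) ⊆ (Ω : Set (ℂ × ℂ))) :
    ∃ C : ℝ, 0 ≤ C ∧ ∀ f : bergmanSpace Ω, ∀ w ∈ ball z R, ‖toFun f w‖ ≤ C * ‖f‖ := by
  obtain ⟨C, hC, h⟩ := exists_norm_le_eLpNorm hR hz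
  refine ⟨C, hC, fun f w hw => ?_⟩
  have h1 := h _ (differentiableOn_toFun f) w hw
  rw [← eLpNorm_congr_ae (coeFn_ae_eq_toFun f), ← Lp.enorm_def, ← ofReal_norm, ← ofReal_norm,
    ← ENNReal.ofReal_mul hC, ENNReal.ofReal_le_ofReal_iff (by positivity)] at h1
  exact h1

theorem exists_ball_subset (z : Ω) : ∃ R > 0, ball (z : ℂ × ℂ) (2 * R) ⊆ (Ω : Set (ℂ × ℂ)) := by
  obtain ⟨ε, hε, h⟩ := Metric.isOpen_iff.mp Ω.isOpen z z.2
  exact ⟨ε / 2, by positivity, by rwa [mul_div_cancel₀ _ two_ne_zero]⟩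

/-- Point evaluation `f ↦ f z`, a bounded linear functional on `A²(Ω)`. -/
noncomputable def eval (z : Ω) : bergmanSpace Ω →L[ℂ] ℂ :=
  LinearMap.mkContinuousOfExistsBound
    { toFun := fun f => toFun f z
      map_add' := fun f g => toFun_add f g z.2
      map_smul' := fun c f => toFun_smul c f z.2 }
    (by
      obtain ⟨R, hR, h⟩ := exists_ball_subset z
      obtain ⟨C, -, hC⟩ := exists_norm_toFun_le hR h
      exact ⟨C, fun f => hC f z (mem_ball_self hR)⟩)

theorem eval_apply (z : Ω) (f : bergmanSpace Ω) : eval z f = toFun f z := rfl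

theorem isClosed :
    IsClosed (bergmanSpace Ω : Set (Lp ℂ 2 ((volume : Measure (ℂ × ℂ)).restrict Ω))) := by
  rw [← isSeqClosed_iff_isClosed]
  intro u f hu hf
  lift u to ℕ → bergmanSpace Ω using hu
  have hcau : CauchySeq u := by
    have := hf.cauchySeq
    rw [Metric.cauchySeq_iff] at this ⊢
    exact this
  have hpt : ∀ z : Ω, ∃ y, Tendsto (fun n => toFun (u n) z) atTop (𝓝 y) := fun z =>
    cauchySeq_tendsto_of_complete ((eval z).uniformContinuous.comp_cauchySeq hcau)
  choose G hG using hpt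
  classical
  let G' : ℂ × ℂ → ℂ := fun z => if hz : z ∈ Ω then G ⟨z, hz⟩ else 0
  have hG' : ∀ z ∈ Ω, Tendsto (fun n => toFun (u n) z) atTop (𝓝 (G' z)) := by
    intro z hz
    simp only [G', hz, dif_pos]
    exact hG ⟨z, hz⟩
  refine ⟨G', fun z hz => ?_, ?_⟩
  · obtain ⟨R, hR, hball⟩ := exists_ball_subset ⟨z, hz⟩
    obtain ⟨C, hC0, hC⟩ := exists_norm_toFun_le hR hball
    have hRΩ : ball z R ⊆ (Ω : Set (ℂ × ℂ)) := (ball_subset_ball (by linarith)).trans hball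
    have hd : ∀ f : bergmanSpace Ω, ∀ w ∈ ball z (R / 2),
        ‖fderiv ℂ (toFun f) w‖ ≤ C * ‖f‖ / (R / 4) := by
      intro f w hw
      have hsub : ball w (2 * (R / 4)) ⊆ ball z R := by
        apply ball_subset_ball'
        rw [mem_ball] at hw
        linarith
      exact norm_fderiv_le_of_ball (by positivity)
        ((differentiableOn_toFun f).mono (hsub.trans hRΩ)) fun x hx => hC f x (hsub hx)
    have hsubΩ : ball z (R / 2) ⊆ (Ω : Set (ℂ × ℂ)) := (ball_subset_ball (by linarith)).trans hRΩ
    have hdiff : ∀ f : bergmanSpace Ω, ∀ w ∈ ball z (R / 2), DifferentiableAt ℂ (toFun f) w :=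
      fun f w hw => (differentiableOn_toFun f).differentiableAt (Ω.isOpen.mem_nhds (hsubΩ hw))
    have hdist : ∀ n m, ∀ w ∈ ball z (R / 2),
        dist (fderiv ℂ (toFun (u n)) w) (fderiv ℂ (toFun (u m)) w)
          ≤ C * dist (u n) (u m) / (R / 4) := by
      intro n m w hw
      rw [dist_eq_norm, dist_eq_norm, ← fderiv_sub (hdiff _ w hw) (hdiff _ w hw)]
      have : fderiv ℂ (toFun (u n) - toFun (u m)) w = fderiv ℂ (toFun (u n - u m)) w := by
        apply Filter.EventuallyEq.fderiv_eq
        filter_upwards [Ω.isOpen.mem_nhds (hsubΩ hw)] with x hx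
        exact (toFun_sub _ _ hx).symm
      rw [this]
      exact hd _ w hw
    have hunif : UniformCauchySeqOn (fun n => fderiv ℂ (toFun (u n))) atTop (ball z (R / 2)) := by
      rw [Metric.uniformCauchySeqOn_iff]
      intro ε hε
      obtain ⟨N, hN⟩ := Metric.cauchySeq_iff.mp hcau (ε * (R / 4) / (C + 1)) (by positivity)
      refine ⟨N, fun m hm n hn w hw => (hdist m n w hw).trans_lt ?_⟩
      have := hN m hm n hn
      rw [lt_div_iff₀ (by positivity)] at this
      rw [div_lt_iff₀ (by positivity)]
      nlinarith [dist_nonneg (x := u m) (y := u n)]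
    have hex : ∀ w, ∃ L : ℂ × ℂ →L[ℂ] ℂ, w ∈ ball z (R / 2) →
        Tendsto (fun n => fderiv ℂ (toFun (u n)) w) atTop (𝓝 L) := by
      intro w
      by_cases hw : w ∈ ball z (R / 2)
      · obtain ⟨L, hL⟩ := cauchySeq_tendsto_of_complete (hunif.cauchySeq hw)
        exact ⟨L, fun _ => hL⟩
      · exact ⟨0, fun h => absurd h hw⟩
    choose L hL using hex
    have := hasFDerivAt_of_tendstoUniformlyOn (f := fun n => toFun (u n)) (g := G') (x := z)
      isOpen_ball (hunif.tendstoUniformlyOn_of_tendsto hL)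
      (fun n x hx => (hdiff (u n) x hx).hasFDerivAt) (fun x hx => hG' x (hsubΩ hx))
      (mem_ball_self (by positivity))
    exact this.differentiableAt.differentiableWithinAt
  · obtain ⟨ns, hns, hae⟩ := (tendstoInMeasure_of_tendsto_Lp hf).exists_seq_tendsto_ae
    have hall : ∀ᵐ x ∂(volume.restrict (Ω : Set (ℂ × ℂ))), ∀ n,
        (u n : Lp ℂ 2 ((volume : Measure (ℂ × ℂ)).restrict Ω)) x = toFun (u n) x :=
      ae_all_iff.mpr fun n => coeFn_ae_eq_toFun (u n)
    filter_upwards [hae, hall, ae_restrict_mem Ω.isOpen.measurableSet] with x h1 h2 h3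
    refine tendsto_nhds_unique h1 ?_
    simp_rw [h2]
    exact (hG' x h3).comp hns.tendsto_atTop

instance : CompleteSpace (bergmanSpace Ω) :=
  (isClosed (Ω := Ω)).completeSpace_coe

/-- The reproducing (Bergman) kernel function `K_z = K_Ω(·; z̄) ∈ A²(Ω)` at `z ∈ Ω`: the Riesz
representative of point evaluation at `z`. -/
noncomputable def kernel (z : Ω) : bergmanSpace Ω :=
  (InnerProductSpace.toDual ℂ (bergmanSpace Ω)).symm (eval z)

theorem inner_kernel (z : Ω) (f : bergmanSpace Ω) : inner ℂ (kernel z) f = toFun f z := by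
  rw [kernel, InnerProductSpace.toDual_symm_apply, eval_apply]

/-- The normalized reproducing kernel `k_z = K_z / ‖K_z‖`. -/
noncomputable def normalizedKernel (z : Ω) : bergmanSpace Ω :=
  ((‖kernel z‖⁻¹ : ℝ) : ℂ) • kernel z

/-- The linear span of the normalized reproducing kernels of `A²(Ω)`. -/
noncomputable def kernelSpan (Ω : Opens (ℂ × ℂ)) : Submodule ℂ (bergmanSpace Ω) :=
  Submodule.span ℂ (Set.range (normalizedKernel (Ω := Ω)))

/-- `k_z` as an element of the linear span of the normalized reproducing kernels. -/
noncomputable def spanKernel (z : Ω) : kernelSpan Ω :=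
  ⟨normalizedKernel z, Submodule.subset_span (Set.mem_range_self z)⟩

end bergmanSpace

end BergmanSpace

section Thullen

open ComplexConjugate

/-- The Thullen domain `U^α = {(z₁, z₂) ∈ ℂ² : |z₁|^(2/α) + |z₂|² < 1}`, for `α > 0`. -/
def thullenDomain (α : ℝ) (hα : 0 < α) : TopologicalSpace.Opens (ℂ × ℂ) where
  carrier := {z | ‖z.1‖ ^ (2 / α) + ‖z.2‖ ^ 2 < 1}
  is_open' := by
    have h1 : Continuous fun z : ℂ × ℂ => ‖z.1‖ ^ (2 / α) :=
      (continuous_norm.comp continuous_fst).rpow_const fun _ => Or.inr (by positivity)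
    exact isOpen_lt (by fun_prop) continuous_const

/-- The Wirtinger derivative `∂g/∂t = (∂g/∂x - i ∂g/∂y) / 2` of `g : ℂ → ℂ` at `t = x + i y`. -/
noncomputable def wirtingerDeriv (g : ℂ → ℂ) (t : ℂ) : ℂ :=
  (lineDeriv ℝ g t 1 - Complex.I * lineDeriv ℝ g t Complex.I) / 2

/-- The holomorphic Jacobian determinant `det (∂Fᵢ/∂wⱼ)` of `F : ℂ² → ℂ²` at `w`. -/
noncomputable def holJacobian (F : ℂ × ℂ → ℂ × ℂ) (w : ℂ × ℂ) : ℂ :=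
  wirtingerDeriv (fun t => (F (t, w.2)).1) w.1 * wirtingerDeriv (fun t => (F (w.1, t)).2) w.2 -
    wirtingerDeriv (fun t => (F (w.1, t)).1) w.2 * wirtingerDeriv (fun t => (F (t, w.2)).2) w.1

/-- The holomorphic automorphism `φ_b` of `U^α` (for `b` in the unit disc),
`φ_b(w) = (w₁ (√(1-|b|²) / (1 - b̄ w₂))^α, (b - w₂) / (1 - b̄ w₂))`. The base of the power has
positive real part on `U^α`, and the power is the principal one. -/
noncomputable def thullenAut (α : ℝ) (b : ℂ) (w : ℂ × ℂ) : ℂ × ℂ :=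
  (w.1 * ((Real.sqrt (1 - ‖b‖ ^ 2) : ℂ) / (1 - conj b * w.2)) ^ (α : ℂ),
    (b - w.2) / (1 - conj b * w.2))

/-- The Möbius map `t ↦ (a - t) / (1 - ā t)` of the unit disc. -/
noncomputable def discMobius (a t : ℂ) : ℂ := (a - t) / (1 - conj a * t)

/-- The (in general not holomorphic) self-map `ϕ_a` of `U^α` (for `a` in the unit disc), with
components `m = (a - w₁) / (1 - ā w₁)` and
`w₂ (√(1-|a|²) / (1 - ā w₁)) √((1-|w₁|²)(1-|m|^(2/α)) / ((1-|w₁|^(2/α))(1-|m|²)))`. -/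
noncomputable def thullenMap (α : ℝ) (a : ℂ) (w : ℂ × ℂ) : ℂ × ℂ :=
  (discMobius a w.1,
    w.2 * ((Real.sqrt (1 - ‖a‖ ^ 2) : ℂ) / (1 - conj a * w.1)) *
      (Real.sqrt (((1 - ‖w.1‖ ^ 2) * (1 - ‖discMobius a w.1‖ ^ (2 / α))) /
        ((1 - ‖w.1‖ ^ (2 / α)) * (1 - ‖discMobius a w.1‖ ^ 2))) : ℂ))

/-- The translation operator `U_z g (w) = g(φ_{z₂}(w)) Jφ_{z₂}(w)`. -/
noncomputable def translU (α : ℝ) (z : ℂ × ℂ) (g : ℂ × ℂ → ℂ) (w : ℂ × ℂ) : ℂ :=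
  g (thullenAut α z.2 w) * holJacobian (thullenAut α z.2) w

/-- The translation operator `V_a g (w) = g(ϕ_a(w)) Jϕ_a(w)`. -/
noncomputable def translV (α : ℝ) (a : ℂ) (g : ℂ × ℂ → ℂ) (w : ℂ × ℂ) : ℂ :=
  g (thullenMap α a w) * holJacobian (thullenMap α a) w

/-- The function `f_α(z) = z₁ / (1 - |z₂|²)^(α/2)`. -/
noncomputable def fAlpha (α : ℝ) (z : ℂ × ℂ) : ℂ :=
  z.1 / (((1 - ‖z.2‖ ^ 2) ^ (α / 2) : ℝ) : ℂ)

end Thullen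

open MeasureTheory Filter Topology Metric ComplexConjugate
open scoped ENNReal

/-! The proof is Schur's test. Write `b = z₂` and `a = f_α(z)`. By duality `Tf(w) = ⟨f, T*K_w⟩`, so
`|Tf(w)|` is at most the integral of `|f(z)|` against the positive kernel `‖K_z‖ |Tk_z(w)| = ‖K_w‖
|T*k_w(z)|`. The kernel span is dense, so it suffices to find a weight `h` with `‖K_z‖ ∫ |Tk_z| h ≤
C h(z)`, and the same for `T*` (`bergmanSpace.exists_clm_extending_of_schur`).

Substitute `w = φ_b(ϕ_a(u))`. Although `ϕ_a` is not holomorphic, its first coordinate depends on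
`u₁` alone and its second is linear in `u₂`, so its real Jacobian is still `|Jϕ_a|²`. One power of
the two Jacobians turns `Tk_z` into `V_a U_z Tk_z`; the other stays with the weight. Hölder with
conjugate exponents `r, q`, where `4 < r ≤ p` and `r` is finite, leaves the `L^q` norm of Jacobian
times weight.

For `h = thullenWeight α q` two estimates close the argument. The `q`-th power of that `L^q` norm is
at most `C (1-|b|²)^(1/3) (1-|a|²)` (`exists_lintegral_jacobian_mul_thullenWeight_rpow_le`). And
`‖K_z‖² ≤ C (1-|b|²)^(-(2+α)) (1-|a|²)^(-3)` (`norm_kernel_sq_mul_le`), by the mean value property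
after moving `z` to `(a, 0)`. Multiplying them gives `C h(z)` (`exists_enorm_kernel_mul_rpow_le`).

The condition `p > 4` means `q < 4/3`. The pointwise majorant contains `|u₁ - a|^(-3q/2)` and a
boundary singularity of order `q - 1/3` in the fibre variable; these are integrable when `3q/2 < 2`
and `q - 1/3 < 1`, which is the same condition. -/

/-! ### Holomorphic change of variables in the plane -/

theorem lintegral_image_eq_lintegral_enorm_deriv_sq_mul {s : Set ℂ} (hs : MeasurableSet s)
    {f f' : ℂ → ℂ} (hf : ∀ x ∈ s, HasDerivAt f (f' x) x) (hinj : Set.InjOn f s) (g : ℂ → ℝ≥0∞) :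
    ∫⁻ y in f '' s, g y = ∫⁻ x in s, ‖f' x‖ₑ ^ 2 * g (f x) := by
  rw [lintegral_image_eq_lintegral_abs_det_fderiv_mul volume hs
    (fun x hx => ((hf x hx).hasFDerivAt.restrictScalars ℝ).hasFDerivWithinAt) hinj]
  refine lintegral_congr fun x => ?_
  congr 1
  -- The real determinant of multiplication by a complex number is its algebra norm over `ℝ`, that
  -- is, its squared modulus.
  have : (ContinuousLinearMap.restrictScalars ℝ
      (ContinuousLinearMap.toSpanSingleton ℂ (f' x))).det = ‖f' x‖ ^ 2 := by
    rw [← Complex.normSq_eq_norm_sq, ← Algebra.norm_complex_apply, Algebra.norm_apply,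
      ContinuousLinearMap.det]
    congr 1
    ext; simp [mul_comm]
  rw [this, abs_of_nonneg (by positivity), ENNReal.ofReal_pow (norm_nonneg _), ofReal_norm]

theorem lintegral_eq_lintegral_comp_mul_left {c : ℂ} (hc : c ≠ 0) (g : ℂ → ℝ≥0∞) :
    ∫⁻ y, g y = ∫⁻ x, ‖c‖ₑ ^ 2 * g (c * x) := by
  have h := lintegral_image_eq_lintegral_enorm_deriv_sq_mul (s := Set.univ) MeasurableSet.univ
    (f := fun x => c * x) (f' := fun _ => c)
    (fun x _ => by simpa using (hasDerivAt_id x).const_mul c)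
    (mul_right_injective₀ hc).injOn g
  rwa [Set.image_univ_of_surjective (fun y => ⟨c⁻¹ * y, by simp [hc]⟩), Measure.restrict_univ]
    at h

theorem setLIntegral_ball_eq_lintegral_ball_one {r : ℝ} (hr : 0 < r) (g : ℂ → ℝ≥0∞) :
    ∫⁻ y in ball 0 r, g y = ENNReal.ofReal (r ^ 2) * ∫⁻ x in ball 0 1, g (r * x) := by
  have hc : (r : ℂ) ≠ 0 := by exact_mod_cast hr.ne'
  rw [← lintegral_indicator measurableSet_ball, lintegral_eq_lintegral_comp_mul_left hc,
    lintegral_const_mul' _ _ (by simp), ← lintegral_indicator measurableSet_ball]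
  congr 1
  · rw [ENNReal.ofReal_pow hr.le, ← ofReal_norm, Complex.norm_real, Real.norm_of_nonneg hr.le]
  · refine lintegral_congr fun x => ?_
    have : (r : ℂ) * x ∈ ball (0 : ℂ) r ↔ x ∈ ball (0 : ℂ) 1 := by
      simp [abs_of_pos hr, mul_lt_iff_lt_one_right hr]
    by_cases hx : x ∈ ball (0 : ℂ) 1
    · rw [Set.indicator_of_mem hx, Set.indicator_of_mem (this.2 hx)]
    · rw [Set.indicator_of_notMem hx, Set.indicator_of_notMem (mt this.1 hx)]

/-! ### Möbius involutions of the disc -/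

section Mobius

variable {a t : ℂ}

theorem one_sub_norm_le_norm_one_sub_conj_mul (ha : ‖a‖ < 1) (t : ℂ) :
    1 - ‖t‖ ≤ ‖1 - conj a * t‖ := by
  have h1 := norm_sub_norm_le (1 : ℂ) (conj a * t)
  rw [norm_one, norm_mul, RCLike.norm_conj] at h1
  nlinarith [norm_nonneg t]

theorem one_sub_conj_mul_ne_zero (ha : ‖a‖ < 1) (ht : ‖t‖ < 1) : 1 - conj a * t ≠ 0 := by
  rw [← norm_pos_iff]
  linarith [one_sub_norm_le_norm_one_sub_conj_mul ha t]

theorem norm_one_sub_conj_mul_sq_sub (a t : ℂ) :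
    ‖1 - conj a * t‖ ^ 2 - ‖a - t‖ ^ 2 = (1 - ‖a‖ ^ 2) * (1 - ‖t‖ ^ 2) := by
  simp only [← Complex.normSq_eq_norm_sq, Complex.normSq_apply]
  simp
  ring

theorem one_sub_norm_discMobius_sq (ha : ‖a‖ < 1) (ht : ‖t‖ < 1) :
    1 - ‖discMobius a t‖ ^ 2 = (1 - ‖a‖ ^ 2) * (1 - ‖t‖ ^ 2) / ‖1 - conj a * t‖ ^ 2 := by
  have h := norm_pos_iff.2 (one_sub_conj_mul_ne_zero ha ht)
  rw [← norm_one_sub_conj_mul_sq_sub, discMobius, norm_div, div_pow, sub_div,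
    div_self (pow_pos h 2).ne']

theorem one_sub_norm_sq_pos (ha : ‖a‖ < 1) : 0 < 1 - ‖a‖ ^ 2 := by
  nlinarith [norm_nonneg a]

theorem norm_discMobius_lt_one (ha : ‖a‖ < 1) (ht : ‖t‖ < 1) : ‖discMobius a t‖ < 1 := by
  have h := one_sub_norm_discMobius_sq ha ht
  have h1 := norm_pos_iff.2 (one_sub_conj_mul_ne_zero ha ht)
  have h2 : 0 < (1 - ‖a‖ ^ 2) * (1 - ‖t‖ ^ 2) / ‖1 - conj a * t‖ ^ 2 := by
    have := one_sub_norm_sq_pos ha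
    have := one_sub_norm_sq_pos ht
    positivity
  nlinarith [norm_nonneg (discMobius a t)]

theorem discMobius_discMobius (ha : ‖a‖ < 1) (ht : ‖t‖ < 1) :
    discMobius a (discMobius a t) = t := by
  have h := one_sub_conj_mul_ne_zero ha ht
  have h1 : (1 : ℂ) - conj a * a ≠ 0 := one_sub_conj_mul_ne_zero ha ha
  unfold discMobius
  have h2 : 1 - conj a * ((a - t) / (1 - conj a * t)) = (1 - conj a * a) / (1 - conj a * t) := by
    rw [eq_div_iff h, sub_mul, mul_assoc, div_mul_cancel₀ _ h]
    ring
  rw [h2, div_div_eq_mul_div, div_eq_iff h1, sub_mul, div_mul_cancel₀ _ h]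
  ring

theorem image_discMobius_ball (ha : ‖a‖ < 1) : discMobius a '' ball 0 1 = ball 0 1 := by
  ext t
  simp only [Set.mem_image, mem_ball_zero_iff]
  constructor
  · rintro ⟨x, hx, rfl⟩
    exact norm_discMobius_lt_one ha hx
  · exact fun ht => ⟨_, norm_discMobius_lt_one ha ht, discMobius_discMobius ha ht⟩

theorem injOn_discMobius (ha : ‖a‖ < 1) : Set.InjOn (discMobius a) (ball 0 1) := by
  intro x hx y hy h
  rw [mem_ball_zero_iff] at hx hy
  rw [← discMobius_discMobius ha hx, h, discMobius_discMobius ha hy]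

/-- The derivative of the Möbius map `discMobius a`. -/
noncomputable def discMobiusDeriv (a t : ℂ) : ℂ := -(1 - ‖a‖ ^ 2) / (1 - conj a * t) ^ 2

theorem hasDerivAt_discMobius (ha : ‖a‖ < 1) (ht : ‖t‖ < 1) :
    HasDerivAt (discMobius a) (discMobiusDeriv a t) t := by
  have h := one_sub_conj_mul_ne_zero ha ht
  have h1 : HasDerivAt (fun t => a - t) (-1) t := (hasDerivAt_id t).const_sub a
  have h2 : HasDerivAt (fun t => 1 - conj a * t) (-conj a) t := by
    simpa using ((hasDerivAt_id t).const_mul (conj a)).const_sub 1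
  refine (h1.div h2 h).congr_deriv ?_
  rw [discMobiusDeriv, ← Complex.conj_mul']
  ring

theorem norm_discMobiusDeriv (ha : ‖a‖ < 1) (t : ℂ) :
    ‖discMobiusDeriv a t‖ = (1 - ‖a‖ ^ 2) / ‖1 - conj a * t‖ ^ 2 := by
  rw [discMobiusDeriv, norm_div, norm_pow, norm_neg]
  congr 1
  rw [← Complex.ofReal_pow, ← Complex.ofReal_one, ← Complex.ofReal_sub, Complex.norm_real,
    Real.norm_of_nonneg (one_sub_norm_sq_pos ha).le]

theorem measurable_discMobius (a : ℂ) : Measurable (discMobius a) := by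
  unfold discMobius
  fun_prop

theorem measurable_discMobiusDeriv (a : ℂ) : Measurable (discMobiusDeriv a) := by
  unfold discMobiusDeriv
  fun_prop

theorem lintegral_ball_comp_discMobius (ha : ‖a‖ < 1) (g : ℂ → ℝ≥0∞) :
    ∫⁻ y in ball 0 1, g y =
      ∫⁻ x in ball 0 1, ‖discMobiusDeriv a x‖ₑ ^ 2 * g (discMobius a x) := by
  conv_lhs => rw [← image_discMobius_ball ha]
  exact lintegral_image_eq_lintegral_enorm_deriv_sq_mul measurableSet_ball
    (fun x hx => hasDerivAt_discMobius ha (mem_ball_zero_iff.1 hx)) (injOn_discMobius ha) g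

/-- Change of variables along the triangular map `(x, y) ↦ (m(x), c(x) y)`, one variable at a time.
Done this way, `c` needs no regularity, only that it does not vanish, so the non-holomorphic
`thullenMap` and the holomorphic `thullenAut` are treated alike. -/
theorem lintegral_ball_lintegral_comp_discMobius_mul (ha : ‖a‖ < 1) {c : ℂ → ℂ}
    (hc : ∀ x, ‖x‖ < 1 → c x ≠ 0) (F : ℂ → ℂ → ℝ≥0∞) :
    ∫⁻ x in ball 0 1, ∫⁻ y, F x y =
      ∫⁻ x in ball 0 1, ∫⁻ y, ‖discMobiusDeriv a x * c x‖ₑ ^ 2 * F (discMobius a x) (c x * y) := by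
  rw [lintegral_ball_comp_discMobius ha]
  refine setLIntegral_congr_fun measurableSet_ball fun x hx => ?_
  rw [lintegral_eq_lintegral_comp_mul_left (hc x (mem_ball_zero_iff.1 hx)),
    ← lintegral_const_mul' _ _ (by simp)]
  simp_rw [enorm_mul, mul_pow, mul_assoc]

end Mobius

/-! ### The self-maps of the Thullen domain and their Jacobians -/

section ThullenMaps

variable {α : ℝ} {a b : ℂ}

theorem mem_thullenDomain {hα : 0 < α} {w : ℂ × ℂ} :
    w ∈ thullenDomain α hα ↔ ‖w.1‖ ^ (2 / α) + ‖w.2‖ ^ 2 < 1 := Iff.rfl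

theorem norm_fst_lt_one_of_mem_thullenDomain {hα : 0 < α} {w : ℂ × ℂ}
    (hw : w ∈ thullenDomain α hα) : ‖w.1‖ < 1 := by
  rw [mem_thullenDomain] at hw
  by_contra! h
  have := Real.one_le_rpow h (z := 2 / α) (by positivity)
  nlinarith [sq_nonneg ‖w.2‖]

theorem norm_snd_lt_one_of_mem_thullenDomain {hα : 0 < α} {w : ℂ × ℂ}
    (hw : w ∈ thullenDomain α hα) : ‖w.2‖ < 1 := by
  rw [mem_thullenDomain] at hw
  have : 0 ≤ ‖w.1‖ ^ (2 / α) := by positivity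
  nlinarith [norm_nonneg w.2]

theorem one_sub_norm_rpow_pos (hα : 0 < α) (ha : ‖a‖ < 1) : 0 < 1 - ‖a‖ ^ (2 / α) :=
  sub_pos.2 (Real.rpow_lt_one (norm_nonneg _) ha (by positivity))

/-- The factor by which `thullenMap α a` multiplies the second coordinate. -/
noncomputable def thullenMapScale (α : ℝ) (a x : ℂ) : ℂ :=
  ((Real.sqrt (1 - ‖a‖ ^ 2) : ℂ) / (1 - conj a * x)) *
    (Real.sqrt (((1 - ‖x‖ ^ 2) * (1 - ‖discMobius a x‖ ^ (2 / α))) /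
      ((1 - ‖x‖ ^ (2 / α)) * (1 - ‖discMobius a x‖ ^ 2))) : ℂ)

/-- The factor by which `thullenAut α b` multiplies the first coordinate. -/
noncomputable def thullenAutScale (α : ℝ) (b t : ℂ) : ℂ :=
  ((Real.sqrt (1 - ‖b‖ ^ 2) : ℂ) / (1 - conj b * t)) ^ (α : ℂ)

theorem thullenMap_eq (w : ℂ × ℂ) :
    thullenMap α a w = (discMobius a w.1, thullenMapScale α a w.1 * w.2) := by
  rw [thullenMap, thullenMapScale, mul_comm _ w.2, mul_assoc]

theorem thullenAut_eq (w : ℂ × ℂ) :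
    thullenAut α b w = (thullenAutScale α b w.2 * w.1, discMobius b w.2) := by
  rw [thullenAut, thullenAutScale, mul_comm w.1, discMobius]

/-- The square root in `thullenMapScale` is built for this: the fibre of the domain over `x` is a
disc of squared radius `1 - |x|^(2/α)`, and the scale carries it onto the fibre over `m(x)`. The
remaining factors cancel by the Möbius identity for `1 - |m|²`. -/
theorem norm_thullenMapScale_sq (hα : 0 < α) (ha : ‖a‖ < 1) {x : ℂ} (hx : ‖x‖ < 1) :
    ‖thullenMapScale α a x‖ ^ 2 = (1 - ‖discMobius a x‖ ^ (2 / α)) / (1 - ‖x‖ ^ (2 / α)) := by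
  have hm := norm_discMobius_lt_one ha hx
  have h1 := one_sub_norm_sq_pos ha
  have h2 := one_sub_norm_sq_pos hx
  have h3 := one_sub_norm_rpow_pos hα hx
  have h4 := one_sub_norm_rpow_pos hα hm
  have h5 := one_sub_norm_sq_pos hm
  have h6 := norm_pos_iff.2 (one_sub_conj_mul_ne_zero ha hx)
  have h7 := one_sub_norm_discMobius_sq ha hx
  rw [thullenMapScale, norm_mul, norm_div, mul_pow, div_pow, Complex.norm_real, Complex.norm_real,
    Real.norm_of_nonneg (Real.sqrt_nonneg _), Real.norm_of_nonneg (Real.sqrt_nonneg _),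
    Real.sq_sqrt h1.le, Real.sq_sqrt (by positivity)]
  rw [eq_div_iff (by positivity)] at h7
  generalize ‖1 - conj a * x‖ = N at *
  generalize ‖discMobius a x‖ ^ (2 / α) = X at *
  generalize ‖discMobius a x‖ ^ 2 = Y at *
  generalize ‖x‖ ^ (2 / α) = Z at *
  rw [div_mul_div_comm, div_eq_div_iff (by positivity) (by positivity)]
  linear_combination (-(1 - X) * (1 - Z)) * h7

theorem thullenMapScale_ne_zero (hα : 0 < α) (ha : ‖a‖ < 1) {x : ℂ} (hx : ‖x‖ < 1) :
    thullenMapScale α a x ≠ 0 := by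
  rw [← norm_ne_zero_iff, ← pow_ne_zero_iff two_ne_zero, norm_thullenMapScale_sq hα ha hx]
  exact (div_pos (one_sub_norm_rpow_pos hα (norm_discMobius_lt_one ha hx))
    (one_sub_norm_rpow_pos hα hx)).ne'

theorem norm_thullenAutScale (t : ℂ) :
    ‖thullenAutScale α b t‖ = (Real.sqrt (1 - ‖b‖ ^ 2) / ‖1 - conj b * t‖) ^ α := by
  rw [thullenAutScale, Complex.norm_cpow_real, norm_div, Complex.norm_real,
    Real.norm_of_nonneg (Real.sqrt_nonneg _)]

theorem thullenAutScale_ne_zero (hb : ‖b‖ < 1) {t : ℂ} (ht : ‖t‖ < 1) :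
    thullenAutScale α b t ≠ 0 := by
  rw [← norm_ne_zero_iff, norm_thullenAutScale]
  exact (Real.rpow_pos_of_pos (div_pos (Real.sqrt_pos.2 (one_sub_norm_sq_pos hb))
    (norm_pos_iff.2 (one_sub_conj_mul_ne_zero hb ht))) _).ne'

theorem norm_thullenAutScale_rpow (hα : 0 < α) (hb : ‖b‖ < 1) (t : ℂ) :
    ‖thullenAutScale α b t‖ ^ (2 / α) = (1 - ‖b‖ ^ 2) / ‖1 - conj b * t‖ ^ 2 := by
  rw [norm_thullenAutScale, ← Real.rpow_mul (by positivity), mul_div_cancel₀ _ hα.ne',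
    Real.rpow_two, div_pow, Real.sq_sqrt (one_sub_norm_sq_pos hb).le]

theorem thullenMap_mem_iff (hα : 0 < α) (ha : ‖a‖ < 1) {w : ℂ × ℂ} (hw : ‖w.1‖ < 1) :
    thullenMap α a w ∈ thullenDomain α hα ↔ w ∈ thullenDomain α hα := by
  have h3 := one_sub_norm_rpow_pos hα hw
  have h4 := one_sub_norm_rpow_pos hα (norm_discMobius_lt_one ha hw)
  rw [mem_thullenDomain, mem_thullenDomain, thullenMap_eq, norm_mul, mul_pow,
    norm_thullenMapScale_sq hα ha hw, ← lt_sub_iff_add_lt', ← lt_sub_iff_add_lt',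
    div_mul_eq_mul_div, div_lt_iff₀ h3, mul_lt_mul_iff_right₀ h4]

/-- The defining function of `thullenDomain` transforms under `thullenAut` like the defining
function of the disc under a Möbius map. -/
theorem thullenAut_defining (hα : 0 < α) (hb : ‖b‖ < 1) {w : ℂ × ℂ} (hw : ‖w.2‖ < 1) :
    1 - ‖(thullenAut α b w).1‖ ^ (2 / α) - ‖(thullenAut α b w).2‖ ^ 2 =
      (1 - ‖b‖ ^ 2) / ‖1 - conj b * w.2‖ ^ 2 * (1 - ‖w.1‖ ^ (2 / α) - ‖w.2‖ ^ 2) := by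
  have h := one_sub_norm_discMobius_sq hb hw
  rw [thullenAut_eq, norm_mul, Real.mul_rpow (norm_nonneg _) (norm_nonneg _),
    norm_thullenAutScale_rpow hα hb]
  linear_combination h

theorem thullenAut_mem_iff (hα : 0 < α) (hb : ‖b‖ < 1) {w : ℂ × ℂ} (hw : ‖w.2‖ < 1) :
    thullenAut α b w ∈ thullenDomain α hα ↔ w ∈ thullenDomain α hα := by
  have h := thullenAut_defining hα hb hw
  have h1 : 0 < (1 - ‖b‖ ^ 2) / ‖1 - conj b * w.2‖ ^ 2 := div_pos (one_sub_norm_sq_pos hb)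
    (pow_pos (norm_pos_iff.2 (one_sub_conj_mul_ne_zero hb hw)) 2)
  rw [mem_thullenDomain, mem_thullenDomain, ← sub_pos, ← sub_pos (b := _ + ‖w.2‖ ^ 2), ← sub_sub,
    ← sub_sub, h, mul_pos_iff_of_pos_left h1]

theorem measurable_thullenMapScale (α : ℝ) (a : ℂ) : Measurable (thullenMapScale α a) := by
  have := measurable_discMobius a
  unfold thullenMapScale
  fun_prop

theorem measurable_thullenAutScale (α : ℝ) (a : ℂ) : Measurable (thullenAutScale α a) := by
  unfold thullenAutScale
  fun_prop

theorem measurable_thullenMap (α : ℝ) (a : ℂ) : Measurable (thullenMap α a) := by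
  have := measurable_discMobius a
  have := measurable_thullenMapScale α a
  rw [funext (thullenMap_eq (α := α) (a := a))]
  fun_prop

theorem measurable_thullenAut (α : ℝ) (a : ℂ) : Measurable (thullenAut α a) := by
  have := measurable_discMobius a
  have := measurable_thullenAutScale α a
  rw [funext (thullenAut_eq (α := α) (b := a))]
  fun_prop

theorem wirtingerDeriv_eq_of_hasDerivAt {g : ℂ → ℂ} {g' t : ℂ} (h : HasDerivAt g g' t) :
    wirtingerDeriv g t = g' := by
  have h1 : ∀ v : ℂ, lineDeriv ℝ g t v = v * g' := fun v => by
    have := (h.hasFDerivAt.restrictScalars ℝ).hasLineDerivAt v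
    simpa using this.lineDeriv
  rw [wirtingerDeriv, h1, h1]
  linear_combination (-g' / 2) * Complex.I_sq

/-- The first coordinate does not involve `w₂`, so the Wirtinger derivative of the scale in `w₁`,
the only non-holomorphic entry, is multiplied by zero and never has to be computed. -/
theorem holJacobian_thullenMap (ha : ‖a‖ < 1) {w : ℂ × ℂ} (hw : ‖w.1‖ < 1) :
    holJacobian (thullenMap α a) w = discMobiusDeriv a w.1 * thullenMapScale α a w.1 := by
  simp only [holJacobian, thullenMap_eq]
  rw [wirtingerDeriv_eq_of_hasDerivAt (hasDerivAt_discMobius ha hw),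
    wirtingerDeriv_eq_of_hasDerivAt ((hasDerivAt_id' w.2).const_mul _),
    wirtingerDeriv_eq_of_hasDerivAt (hasDerivAt_const w.2 _)]
  simp

theorem holJacobian_thullenAut (hb : ‖b‖ < 1) {w : ℂ × ℂ} (hw : ‖w.2‖ < 1) :
    holJacobian (thullenAut α b) w = discMobiusDeriv b w.2 * thullenAutScale α b w.2 := by
  simp only [holJacobian, thullenAut_eq]
  rw [wirtingerDeriv_eq_of_hasDerivAt ((hasDerivAt_id' w.1).const_mul _),
    wirtingerDeriv_eq_of_hasDerivAt (hasDerivAt_discMobius hb hw),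
    wirtingerDeriv_eq_of_hasDerivAt (hasDerivAt_const w.1 (discMobius b w.2))]
  simp [mul_comm]

theorem setLIntegral_thullenDomain_eq (hα : 0 < α) {F : ℂ × ℂ → ℝ≥0∞} (hF : Measurable F) :
    ∫⁻ w in thullenDomain α hα, F w =
      ∫⁻ x in ball 0 1, ∫⁻ y, (thullenDomain α hα : Set (ℂ × ℂ)).indicator F (x, y) := by
  rw [← lintegral_indicator (thullenDomain α hα).isOpen.measurableSet,
    Measure.volume_eq_prod, lintegral_prod _
      (hF.indicator (thullenDomain α hα).isOpen.measurableSet).aemeasurable,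
    ← lintegral_indicator measurableSet_ball]
  refine lintegral_congr fun x => ?_
  by_cases hx : x ∈ ball (0 : ℂ) 1
  · rw [Set.indicator_of_mem hx]
  · rw [Set.indicator_of_notMem hx, lintegral_eq_zero_iff' (by
      apply Measurable.aemeasurable
      have := hF.indicator (thullenDomain α hα).isOpen.measurableSet
      fun_prop)]
    refine Eventually.of_forall fun y => ?_
    refine Set.indicator_of_notMem (fun h => hx ?_) _
    exact mem_ball_zero_iff.2 (norm_fst_lt_one_of_mem_thullenDomain h)

theorem setLIntegral_thullenDomain_eq_swap (hα : 0 < α) {F : ℂ × ℂ → ℝ≥0∞} (hF : Measurable F) :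
    ∫⁻ w in thullenDomain α hα, F w =
      ∫⁻ y in ball 0 1, ∫⁻ x, (thullenDomain α hα : Set (ℂ × ℂ)).indicator F (x, y) := by
  rw [← lintegral_indicator (thullenDomain α hα).isOpen.measurableSet,
    Measure.volume_eq_prod, lintegral_prod_symm _
      (hF.indicator (thullenDomain α hα).isOpen.measurableSet).aemeasurable,
    ← lintegral_indicator measurableSet_ball]
  refine lintegral_congr fun x => ?_
  by_cases hx : x ∈ ball (0 : ℂ) 1
  · rw [Set.indicator_of_mem hx]
  · rw [Set.indicator_of_notMem hx, lintegral_eq_zero_iff' (by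
      apply Measurable.aemeasurable
      have := hF.indicator (thullenDomain α hα).isOpen.measurableSet
      fun_prop)]
    refine Eventually.of_forall fun y => ?_
    refine Set.indicator_of_notMem (fun h => hx ?_) _
    exact mem_ball_zero_iff.2 (norm_snd_lt_one_of_mem_thullenDomain h)

theorem lintegral_thullenDomain_comp_thullenMap (hα : 0 < α) (ha : ‖a‖ < 1)
    {F : ℂ × ℂ → ℝ≥0∞} (hF : Measurable F) :
    ∫⁻ w in thullenDomain α hα, F w = ∫⁻ u in thullenDomain α hα,
      ‖discMobiusDeriv a u.1 * thullenMapScale α a u.1‖ₑ ^ 2 * F (thullenMap α a u) := by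
  have h1 := measurable_discMobiusDeriv a
  have h2 := measurable_thullenMapScale α a
  have h3 := measurable_thullenMap α a
  rw [setLIntegral_thullenDomain_eq hα hF, setLIntegral_thullenDomain_eq hα (by fun_prop),
    lintegral_ball_lintegral_comp_discMobius_mul ha
      (fun x hx => thullenMapScale_ne_zero (α := α) hα ha hx)]
  refine setLIntegral_congr_fun measurableSet_ball fun x hx => ?_
  refine lintegral_congr fun y => ?_
  have h := thullenMap_mem_iff hα ha (w := (x, y)) (mem_ball_zero_iff.1 hx)
  have e : (discMobius a x, thullenMapScale α a x * y) = thullenMap α a (x, y) :=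
    (thullenMap_eq (x, y)).symm
  rw [e]
  by_cases hm : (x, y) ∈ thullenDomain α hα
  · rw [Set.indicator_of_mem (h.2 hm), Set.indicator_of_mem hm]
  · rw [Set.indicator_of_notMem (mt h.1 hm), Set.indicator_of_notMem hm, mul_zero]

theorem lintegral_thullenDomain_comp_thullenAut (hα : 0 < α) (hb : ‖b‖ < 1)
    {F : ℂ × ℂ → ℝ≥0∞} (hF : Measurable F) :
    ∫⁻ w in thullenDomain α hα, F w = ∫⁻ u in thullenDomain α hα,
      ‖discMobiusDeriv b u.2 * thullenAutScale α b u.2‖ₑ ^ 2 * F (thullenAut α b u) := by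
  have h1 := measurable_discMobiusDeriv b
  have h2 := measurable_thullenAutScale α b
  have h3 := measurable_thullenAut α b
  rw [setLIntegral_thullenDomain_eq_swap hα hF, setLIntegral_thullenDomain_eq_swap hα
      (by fun_prop),
    lintegral_ball_lintegral_comp_discMobius_mul hb
      (fun x hx => thullenAutScale_ne_zero (α := α) hb hx) (fun y x =>
        (thullenDomain α hα : Set (ℂ × ℂ)).indicator F (x, y))]
  refine setLIntegral_congr_fun measurableSet_ball fun y hy => ?_
  refine lintegral_congr fun x => ?_
  have h := thullenAut_mem_iff hα hb (w := (x, y)) (mem_ball_zero_iff.1 hy)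
  have e : (thullenAutScale α b y * x, discMobius b y) = thullenAut α b (x, y) :=
    (thullenAut_eq (x, y)).symm
  rw [e]
  by_cases hm : (x, y) ∈ thullenDomain α hα
  · rw [Set.indicator_of_mem (h.2 hm), Set.indicator_of_mem hm]
  · rw [Set.indicator_of_notMem (mt h.1 hm), Set.indicator_of_notMem hm, mul_zero]

end ThullenMaps

/-! ### Schur's test -/

/-- Cauchy–Schwarz for the splitting `k f = (k h)^(1/2) (k f² / h)^(1/2)`. -/
theorem ENNReal.lintegral_mul_sq_le_of_weight {X : Type*} [MeasurableSpace X] {μ : Measure X}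
    {k f h : X → ℝ≥0∞} (hk : Measurable k) (hf : Measurable f) (hh : Measurable h)
    (h0 : ∀ x, h x ≠ 0) (ht : ∀ x, h x ≠ ∞) :
    (∫⁻ x, k x * f x ∂μ) ^ 2 ≤
      (∫⁻ x, k x * h x ∂μ) * ∫⁻ x, k x * (f x ^ 2 * (h x)⁻¹) ∂μ := by
  have hs : ∀ y : ℝ≥0∞, (y ^ (1 / 2 : ℝ)) ^ (2 : ℝ) = y := fun y => by
    rw [← ENNReal.rpow_mul]; norm_num
  have key := ENNReal.lintegral_mul_le_Lp_mul_Lq μ Real.HolderConjugate.two_two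
    (f := fun x => (k x * h x) ^ (1 / 2 : ℝ))
    (g := fun x => (k x * (f x ^ 2 * (h x)⁻¹)) ^ (1 / 2 : ℝ)) (by fun_prop) (by fun_prop)
  have e : ∀ x, k x * f x =
      (k x * h x) ^ (1 / 2 : ℝ) * (k x * (f x ^ 2 * (h x)⁻¹)) ^ (1 / 2 : ℝ) := fun x => by
    rw [← ENNReal.mul_rpow_of_nonneg _ _ (by norm_num)]
    have : k x * h x * (k x * (f x ^ 2 * (h x)⁻¹)) = (k x * f x) ^ (2 : ℝ) := by
      rw [ENNReal.rpow_two]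
      calc _ = (k x * f x) ^ 2 * (h x * (h x)⁻¹) := by ring
        _ = _ := by rw [ENNReal.mul_inv_cancel (h0 x) (ht x), mul_one]
    rw [this, ← ENNReal.rpow_mul]; norm_num
  simp only [Pi.mul_apply, hs] at key
  simp_rw [← e] at key
  calc _ ≤ ((∫⁻ x, k x * h x ∂μ) ^ (1 / 2 : ℝ) *
        (∫⁻ x, k x * (f x ^ 2 * (h x)⁻¹) ∂μ) ^ (1 / 2 : ℝ)) ^ 2 := by gcongr
    _ = _ := by rw [mul_pow, ← ENNReal.rpow_two, ← ENNReal.rpow_two, hs, hs]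

/-- **Schur's test**, with the same weight on both sides. -/
theorem lintegral_lintegral_mul_sq_le_of_schur {X : Type*} [MeasurableSpace X] {μ : Measure X}
    [SFinite μ] {k : X → X → ℝ≥0∞} {f h : X → ℝ≥0∞} (hk : Measurable (Function.uncurry k))
    (hf : Measurable f) (hh : Measurable h) (h0 : ∀ x, h x ≠ 0) (ht : ∀ x, h x ≠ ∞) {C : ℝ≥0∞}
    (h1 : ∀ z, ∫⁻ w, k z w * h w ∂μ ≤ C * h z) (h2 : ∀ w, ∫⁻ z, k z w * h z ∂μ ≤ C * h w) :
    ∫⁻ w, (∫⁻ z, k z w * f z ∂μ) ^ 2 ∂μ ≤ C ^ 2 * ∫⁻ z, f z ^ 2 ∂μ := by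
  have hkz : ∀ z, Measurable fun w => k z w := fun z => hk.comp measurable_prodMk_left
  have hkw : ∀ w, Measurable fun z => k z w := fun w => hk.comp measurable_prodMk_right
  have hk' : Measurable fun p : X × X => k p.2 p.1 := hk.comp measurable_swap
  calc ∫⁻ w, (∫⁻ z, k z w * f z ∂μ) ^ 2 ∂μ
      ≤ ∫⁻ w, ∫⁻ z, C * h w * (k z w * (f z ^ 2 * (h z)⁻¹)) ∂μ ∂μ := by
        refine lintegral_mono fun w => ?_
        have := hkw w
        rw [lintegral_const_mul _ (by fun_prop)]
        refine (ENNReal.lintegral_mul_sq_le_of_weight (hkw w) hf hh h0 ht).trans ?_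
        gcongr
        exact h2 w
    _ = ∫⁻ z, ∫⁻ w, C * (f z ^ 2 * (h z)⁻¹) * (k z w * h w) ∂μ ∂μ := by
        rw [lintegral_lintegral_swap (by unfold Function.uncurry; fun_prop)]
        congr! 4
        ring
    _ ≤ ∫⁻ z, C ^ 2 * f z ^ 2 ∂μ := by
        refine lintegral_mono fun z => ?_
        have := hkz z
        rw [lintegral_const_mul _ (by fun_prop)]
        calc _ ≤ C * (f z ^ 2 * (h z)⁻¹) * (C * h z) := by gcongr; exact h1 z
          _ = C ^ 2 * f z ^ 2 * (h z * (h z)⁻¹) := by ring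
          _ = _ := by rw [ENNReal.mul_inv_cancel (h0 z) (ht z), mul_one]
    _ = _ := lintegral_const_mul _ (by fun_prop)

theorem norm_le_of_enorm_le {E F : Type*} [SeminormedAddCommGroup E] [SeminormedAddCommGroup F]
    {x : E} {y : F} {C : ℝ≥0∞} (hC : C ≠ ∞) (h : ‖x‖ₑ ≤ C * ‖y‖ₑ) : ‖x‖ ≤ C.toReal * ‖y‖ := by
  rwa [← ENNReal.ofReal_toReal hC, ← ofReal_norm x, ← ofReal_norm y,
    ← ENNReal.ofReal_mul ENNReal.toReal_nonneg,
    ENNReal.ofReal_le_ofReal_iff (by positivity)] at h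

theorem exists_clm_extending_of_dense {E F : Type*} [NormedAddCommGroup E] [NormedSpace ℂ E]
    [NormedAddCommGroup F] [NormedSpace ℂ F] [CompleteSpace F] {V : Submodule ℂ E}
    (hV : Dense (V : Set E)) (T : V →ₗ[ℂ] F) {C : ℝ} (hT : ∀ f : V, ‖T f‖ ≤ C * ‖(f : E)‖) :
    ∃ S : E →L[ℂ] F, ∀ f : V, S f = T f := by
  have hd : DenseRange V.subtype := by
    rwa [DenseRange, Submodule.coe_subtype, Subtype.range_coe]
  exact ⟨T.extendOfNorm V.subtype, fun f => LinearMap.extendOfNorm_eq hd ⟨C, hT⟩ f⟩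

/-! ### Schur's test for operators given on the normalized kernels -/

namespace bergmanSpace

variable {Ω : TopologicalSpace.Opens (ℂ × ℂ)}

theorem kernel_eq_smul (z : Ω) : kernel z = ((‖kernel z‖ : ℝ) : ℂ) • normalizedKernel z := by
  rw [normalizedKernel, smul_smul]
  by_cases h : ‖kernel z‖ = 0
  · rw [norm_eq_zero.1 h]; simp
  · rw [← Complex.ofReal_mul, mul_inv_cancel₀ h, Complex.ofReal_one, one_smul]

theorem toFun_eq_inner (z : Ω) (f : bergmanSpace Ω) :
    toFun f z = ‖kernel z‖ * inner ℂ (normalizedKernel z) f := by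
  rw [← inner_kernel]
  conv_lhs => rw [kernel_eq_smul]
  rw [inner_smul_left (𝕜 := ℂ) (E := bergmanSpace Ω), Complex.conj_ofReal]

theorem enorm_toFun_eq (z : Ω) (f : bergmanSpace Ω) :
    ‖toFun f z‖ₑ = ‖kernel z‖ₑ * ‖(inner ℂ (normalizedKernel z) f : ℂ)‖ₑ := by
  rw [toFun_eq_inner, enorm_mul, ← ofReal_norm (E := ℂ), Complex.norm_real, norm_norm, ofReal_norm]

theorem enorm_inner_comm (f g : bergmanSpace Ω) : ‖(inner ℂ f g : ℂ)‖ₑ = ‖(inner ℂ g f : ℂ)‖ₑ := by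
  rw [← inner_conj_symm (𝕜 := ℂ) (E := bergmanSpace Ω), RCLike.enorm_conj]

theorem norm_kernel_sq (z : Ω) : ‖kernel z‖ ^ 2 = ‖toFun (kernel z) z‖ := by
  rw [← inner_kernel, inner_self_eq_norm_sq_to_K (𝕜 := ℂ) (E := bergmanSpace Ω), norm_pow,
    RCLike.norm_ofReal, abs_norm]

/-- A function orthogonal to every kernel vanishes at every point, by the reproducing property. -/
theorem kernelSpan_dense : Dense (kernelSpan Ω : Set (bergmanSpace Ω)) := by
  rw [Submodule.dense_iff_topologicalClosure_eq_top, Submodule.topologicalClosure_eq_top_iff,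
    Submodule.eq_bot_iff]
  intro f hf
  rw [Submodule.mem_orthogonal] at hf
  have h0 : Set.EqOn (toFun f) 0 Ω := fun z hz => by
    rw [toFun_eq_inner ⟨z, hz⟩, hf _ (Submodule.subset_span (Set.mem_range_self _)), mul_zero]
    rfl
  have : (f : Lp ℂ 2 ((volume : Measure (ℂ × ℂ)).restrict Ω)) = 0 := by
    rw [Lp.eq_zero_iff_ae_eq_zero]
    filter_upwards [coeFn_ae_eq_toFun f, ae_restrict_mem Ω.isOpen.measurableSet] with x h1 h2
    rw [h1, h0 h2]
  exact Subtype.ext this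

theorem kernelSpan_hom_ext {L₁ L₂ : kernelSpan Ω →ₗ[ℂ] ℂ}
    (h : ∀ z, L₁ (spanKernel z) = L₂ (spanKernel z)) : L₁ = L₂ := by
  refine LinearMap.ext_on (Submodule.span_span_coe_preimage
    (s := Set.range (normalizedKernel (Ω := Ω)))) ?_
  rintro ⟨x, hx⟩ ⟨z, hz⟩
  subst hz
  exact h z

theorem enorm_sq_eq_lintegral (f : bergmanSpace Ω) :
    ‖f‖ₑ ^ 2 = ∫⁻ w in Ω, ‖toFun f w‖ₑ ^ 2 := by
  have h : ‖f‖ₑ = ‖(f : Lp ℂ 2 ((volume : Measure (ℂ × ℂ)).restrict Ω))‖ₑ := rfl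
  rw [h, Lp.enorm_def, eLpNorm_congr_ae (coeFn_ae_eq_toFun f),
    eLpNorm_eq_lintegral_rpow_enorm_toReal (by norm_num) (by norm_num), ← ENNReal.rpow_two,
    ← ENNReal.rpow_mul]
  norm_num

theorem enorm_inner_le_lintegral (f g : bergmanSpace Ω) :
    ‖(inner ℂ f g : ℂ)‖ₑ ≤ ∫⁻ w in Ω, ‖toFun f w‖ₑ * ‖toFun g w‖ₑ := by
  rw [Submodule.coe_inner, L2.inner_def]
  refine (enorm_integral_le_lintegral_enorm _).trans (le_of_eq (lintegral_congr_ae ?_))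
  filter_upwards [coeFn_ae_eq_toFun f, coeFn_ae_eq_toFun g] with x h1 h2
  rw [h1, h2, RCLike.inner_apply, enorm_mul, mul_comm, RCLike.enorm_conj]

theorem continuous_toFun_restrict (f : bergmanSpace Ω) : Continuous fun w : Ω => toFun f w :=
  (differentiableOn_toFun f).continuousOn.comp_continuous continuous_subtype_val fun w => w.2

/-- Schur's test for an operator `T` on the span of the normalized kernels, with adjoint `T'`. -/
theorem exists_clm_extending_of_schur (T T' : kernelSpan Ω →ₗ[ℂ] bergmanSpace Ω)
    (hdual : ∀ z w : Ω, inner ℂ (normalizedKernel w) (T (spanKernel z)) =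
      inner ℂ (T' (spanKernel w)) (normalizedKernel z))
    {h : ℂ × ℂ → ℝ≥0∞} (hh : Measurable h) (h0 : ∀ z ∈ Ω, h z ≠ 0) (ht : ∀ z ∈ Ω, h z ≠ ∞)
    {C : ℝ≥0∞} (hC : C ≠ ∞)
    (h1 : ∀ z : Ω, ‖kernel z‖ₑ * ∫⁻ w in Ω, ‖toFun (T (spanKernel z)) w‖ₑ * h w ≤ C * h z)
    (h2 : ∀ z : Ω, ‖kernel z‖ₑ * ∫⁻ w in Ω, ‖toFun (T' (spanKernel z)) w‖ₑ * h w ≤ C * h z) :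
    ∃ S : bergmanSpace Ω →L[ℂ] bergmanSpace Ω, ∀ f : kernelSpan Ω, S f = T f := by
  -- Schur's test wants a weight that is positive and finite everywhere, and `h` is so only on `Ω`;
  -- hence the measure space is the subtype.
  set μ : Measure Ω := Measure.comap Subtype.val volume with hμ
  have hsub : ∀ g : ℂ × ℂ → ℝ≥0∞, ∫⁻ w : Ω, g w ∂μ = ∫⁻ w in Ω, g w := fun g =>
    lintegral_subtype_comap Ω.isOpen.measurableSet g
  have : SFinite μ := by
    have : IsFiniteMeasureOnCompacts μ := .comap' _ continuous_subtype_val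
      (MeasurableEmbedding.subtype_coe Ω.isOpen.measurableSet)
    have : LocallyCompactSpace Ω := Ω.isOpen.locallyCompactSpace
    infer_instance
  set k : Ω → Ω → ℝ≥0∞ := fun z w => ‖kernel z‖ₑ * ‖toFun (T (spanKernel z)) w‖ₑ with hk
  -- Both expressions equal `‖K_z‖ ‖K_w‖ |⟨Tk_z, k_w⟩|`. This symmetry turns the hypothesis on `T'`
  -- into the second Schur inequality.
  have hkT' : ∀ z w, k z w = ‖kernel w‖ₑ * ‖toFun (T' (spanKernel w)) z‖ₑ := fun z w => by
    have h3 := enorm_toFun_eq w (T (spanKernel z))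
    have h4 := enorm_toFun_eq z (T' (spanKernel w))
    rw [enorm_inner_comm, ← hdual] at h4
    simp only [hk, h3, h4]
    exact mul_left_comm _ _ _
  -- The kernel is continuous in each variable separately, in `w` through `T` and in `z` through
  -- `T'`. That is enough for joint measurability.
  have hkm : Measurable (Function.uncurry k) := by
    refine (stronglyMeasurable_uncurry_of_continuous_of_stronglyMeasurable (fun w => ?_)
      fun z => ?_).measurable
    · simp_rw [hkT']
      exact ENNReal.continuous_const_mul (by simp) |>.comp (continuous_toFun_restrict _).enorm
    · exact (ENNReal.continuous_const_mul (by simp) |>.comp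
        (continuous_toFun_restrict _).enorm).stronglyMeasurable
  -- For fixed `w`, pairing `Tf` with `k_w` and pairing `f` with `T'k_w` are linear in `f` and agree
  -- on the kernels, hence on their span.
  have hT : ∀ (f : kernelSpan Ω) (w : Ω),
      toFun (T f) w = ‖kernel w‖ * inner ℂ (T' (spanKernel w)) (f : bergmanSpace Ω) := by
    intro f w
    rw [toFun_eq_inner]
    congr 1
    exact LinearMap.congr_fun (kernelSpan_hom_ext
      (L₁ := (innerSL ℂ (normalizedKernel w)).toLinearMap ∘ₗ T)
      (L₂ := (innerSL ℂ (T' (spanKernel w))).toLinearMap ∘ₗ (kernelSpan Ω).subtype)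
      fun z => hdual z w) f
  have hbound : ∀ f : kernelSpan Ω, ‖T f‖ ≤ C.toReal * ‖(f : bergmanSpace Ω)‖ := by
    intro f
    have hfm : Measurable fun w : Ω => ‖toFun (f : bergmanSpace Ω) w‖ₑ :=
      (continuous_toFun_restrict _).enorm.measurable
    have key := lintegral_lintegral_mul_sq_le_of_schur (μ := μ) hkm hfm
      (hh.comp measurable_subtype_coe) (fun z => h0 z z.2) (fun z => ht z z.2) (C := C)
      (fun z => by
        simp only [hk, Function.comp, mul_assoc]
        rw [lintegral_const_mul' _ _ (by simp),
          hsub fun w => ‖toFun (T (spanKernel z)) w‖ₑ * h w]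
        exact h1 z)
      (fun w => by
        simp only [hkT', Function.comp, mul_assoc]
        rw [lintegral_const_mul' _ _ (by simp),
          hsub fun z => ‖toFun (T' (spanKernel w)) z‖ₑ * h z]
        exact h2 w)
    rw [hsub fun w => ‖toFun (f : bergmanSpace Ω) w‖ₑ ^ 2, ← enorm_sq_eq_lintegral] at key
    have h3 : ‖T f‖ₑ ^ 2 ≤ (C * ‖(f : bergmanSpace Ω)‖ₑ) ^ 2 := by
      rw [mul_pow, enorm_sq_eq_lintegral, ← hsub fun w => ‖toFun (T f) w‖ₑ ^ 2]
      refine le_trans (lintegral_mono fun w => ?_) key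
      gcongr
      rw [hT, enorm_mul, ← ofReal_norm (E := ℂ) ((‖kernel w‖ : ℝ) : ℂ), Complex.norm_real,
        norm_norm, ofReal_norm]
      simp only [hkT', mul_assoc]
      rw [lintegral_const_mul' _ _ (by simp),
        hsub fun z => ‖toFun (T' (spanKernel w)) z‖ₑ * ‖toFun (f : bergmanSpace Ω) z‖ₑ]
      gcongr
      exact enorm_inner_le_lintegral _ _
    exact norm_le_of_enorm_le hC ((ENNReal.pow_le_pow_left_iff two_ne_zero).1 h3)
  exact exists_clm_extending_of_dense kernelSpan_dense T hbound

end bergmanSpace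

/-! ### Comparison of `1 - |x|^(2/α)` with `1 - |x|²` -/

/-- Monotonicity in the exponent if `γ ≥ 1`, Bernoulli's inequality if `γ ≤ 1`; for the upper bound
that follows, the two roles are exchanged. -/
theorem min_one_mul_one_sub_le_one_sub_rpow {y γ : ℝ} (hy0 : 0 ≤ y) (hy1 : y ≤ 1) (hγ : 0 < γ) :
    min 1 γ * (1 - y) ≤ 1 - y ^ γ := by
  rcases le_total 1 γ with h | h
  · rw [min_eq_left h, one_mul]
    have := Real.rpow_le_rpow_of_exponent_ge' hy0 hy1 zero_le_one h
    rw [Real.rpow_one] at this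
    linarith
  · rw [min_eq_right h]
    have := rpow_one_add_le_one_add_mul_self (s := y - 1) (by linarith) hγ.le h
    rw [add_sub_cancel] at this
    linarith

theorem one_sub_rpow_le_max_one_mul_one_sub {y γ : ℝ} (hy0 : 0 ≤ y) (hy1 : y ≤ 1) (hγ : 0 < γ) :
    1 - y ^ γ ≤ max 1 γ * (1 - y) := by
  rcases le_total 1 γ with h | h
  · rw [max_eq_right h]
    have := one_add_mul_self_le_rpow_one_add (s := y - 1) (by linarith) h
    rw [add_sub_cancel] at this
    linarith
  · rw [max_eq_left h, one_mul]
    have := Real.rpow_le_rpow_of_exponent_ge' hy0 hy1 hγ.le h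
    rw [Real.rpow_one] at this
    linarith

section Comparison

variable {α : ℝ} {x : ℂ}

theorem norm_rpow_two_div (α : ℝ) (x : ℂ) : ‖x‖ ^ (2 / α) = (‖x‖ ^ 2) ^ (1 / α) := by
  rw [← Real.rpow_two, ← Real.rpow_mul (norm_nonneg _)]
  congr 1
  ring

theorem min_mul_one_sub_norm_sq_le (hα : 0 < α) (hx : ‖x‖ < 1) :
    min 1 (1 / α) * (1 - ‖x‖ ^ 2) ≤ 1 - ‖x‖ ^ (2 / α) := by
  rw [norm_rpow_two_div]
  exact min_one_mul_one_sub_le_one_sub_rpow (by positivity)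
    (by linarith [one_sub_norm_sq_pos hx]) (by positivity)

theorem one_sub_norm_rpow_le_max_mul (hα : 0 < α) (hx : ‖x‖ < 1) :
    1 - ‖x‖ ^ (2 / α) ≤ max 1 (1 / α) * (1 - ‖x‖ ^ 2) := by
  rw [norm_rpow_two_div]
  exact one_sub_rpow_le_max_one_mul_one_sub (by positivity)
    (by linarith [one_sub_norm_sq_pos hx]) (by positivity)

end Comparison

/-! ### Upper bound for the Bergman kernel on the diagonal -/

/-- Two independent radii are needed: around `(a, 0)` the polydisc used below has radius of order `1
- |a|` in the first variable but `(1 - |a|)^(1/2)` in the second. -/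
theorem enorm_mul_le_lintegral_polydisc {F : ℂ × ℂ → ℂ} {z : ℂ × ℂ} {R S : ℝ} (hR : 0 < R)
    (hS : 0 < S) (hF : DifferentiableOn ℂ F (ball z.1 R ×ˢ ball z.2 S)) :
    ‖F z‖ₑ * ENNReal.ofReal (R ^ 2) * ENNReal.ofReal (S ^ 2) ≤
      ∫⁻ x in ball z.1 R ×ˢ ball z.2 S, ‖F x‖ₑ := by
  obtain ⟨z1, z2⟩ := z
  dsimp only at hF ⊢
  have hFm : AEMeasurable (fun x => ‖F x‖ₑ)
      ((volume.restrict (ball z1 R)).prod (volume.restrict (ball z2 S))) := by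
    rw [Measure.prod_restrict, ← Measure.volume_eq_prod]
    exact hF.continuousOn.enorm.aemeasurable (measurableSet_ball.prod measurableSet_ball)
  rw [Measure.volume_eq_prod, ← Measure.prod_restrict, lintegral_prod _ hFm]
  have h1 : DifferentiableOn ℂ (fun t => F (t, z2)) (ball z1 R) :=
    hF.comp (by fun_prop) fun t ht => ⟨ht, mem_ball_self hS⟩
  replace h1 := BergmanAux.enorm_mul_le_lintegral_ball hR h1
  calc _ ≤ (∫⁻ x in ball z1 R, ‖F (x, z2)‖ₑ) * ENNReal.ofReal (S ^ 2) := by gcongr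
    _ = ∫⁻ x in ball z1 R, ‖F (x, z2)‖ₑ * ENNReal.ofReal (S ^ 2) := by
        rw [lintegral_mul_const' _ _ ENNReal.ofReal_ne_top]
    _ ≤ _ := by
        refine setLIntegral_mono' measurableSet_ball fun x hx => ?_
        exact BergmanAux.enorm_mul_le_lintegral_ball hS
          (hF.comp (by fun_prop) fun t ht => ⟨hx, ht⟩)

section KernelBound

open bergmanSpace

variable {α : ℝ}

/-- The base of the power lies in the right half-plane, away from the branch cut. -/
theorem differentiableAt_thullenAutScale {b t : ℂ} (hb : ‖b‖ < 1) (ht : ‖t‖ < 1) :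
    DifferentiableAt ℂ (thullenAutScale α b) t := by
  have h1 := one_sub_conj_mul_ne_zero hb ht
  have hbt : ‖conj b * t‖ < 1 := by
    rw [norm_mul, RCLike.norm_conj]
    nlinarith [norm_nonneg b, norm_nonneg t]
  unfold thullenAutScale
  have h2 : DifferentiableAt ℂ (fun t => (Real.sqrt (1 - ‖b‖ ^ 2) : ℂ) / (1 - conj b * t)) t :=
    (differentiableAt_const _).div (by fun_prop) h1
  refine h2.cpow (differentiableAt_const _) (Or.inl ?_)
  have h3 : 0 < (1 - conj b * t).re := by
    have := Complex.re_le_norm (conj b * t)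
    rw [Complex.sub_re, Complex.one_re]
    linarith
  have h4 : 0 < Complex.normSq (1 - conj b * t) := Complex.normSq_pos.2 h1
  rw [div_eq_mul_inv, Complex.re_ofReal_mul, Complex.inv_re]
  exact mul_pos (Real.sqrt_pos.2 (one_sub_norm_sq_pos hb)) (div_pos h3 h4)

/-- This is the role of `fAlpha`: the automorphism `φ_{z₂}` carries the point `(f_α(z), 0)` of the
slice `w₂ = 0` to `z`. -/
theorem thullenAut_fAlpha {z : ℂ × ℂ} (hz : ‖z.2‖ < 1) :
    thullenAut α z.2 (fAlpha α z, 0) = z := by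
  have h := one_sub_norm_sq_pos hz
  have h1 : thullenAutScale α z.2 0 = (((1 - ‖z.2‖ ^ 2) ^ (α / 2) : ℝ) : ℂ) := by
    rw [thullenAutScale, mul_zero, sub_zero, div_one, ← Complex.ofReal_cpow (Real.sqrt_nonneg _),
      Real.sqrt_eq_rpow, ← Real.rpow_mul h.le]
    congr 2
    ring
  have h2 : (((1 - ‖z.2‖ ^ 2) ^ (α / 2) : ℝ) : ℂ) ≠ 0 := by
    exact_mod_cast (Real.rpow_pos_of_pos h _).ne'
  rw [thullenAut_eq]
  dsimp only
  rw [h1, fAlpha, mul_div_cancel₀ _ h2, discMobius]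
  simp

theorem norm_fAlpha_lt_one {hα : 0 < α} {z : ℂ × ℂ} (hz : z ∈ thullenDomain α hα) :
    ‖fAlpha α z‖ < 1 := by
  have h := norm_snd_lt_one_of_mem_thullenDomain hz
  rw [← thullenAut_fAlpha (α := α) h, thullenAut_mem_iff hα h (by simp)] at hz
  exact norm_fst_lt_one_of_mem_thullenDomain hz

theorem norm_discMobiusDeriv_mul_thullenAutScale {b t : ℂ} (hb : ‖b‖ < 1) (ht : ‖t‖ < 1) :
    ‖discMobiusDeriv b t * thullenAutScale α b t‖ =
      (1 - ‖b‖ ^ 2) ^ (1 + α / 2) / ‖1 - conj b * t‖ ^ (2 + α) := by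
  have h := one_sub_norm_sq_pos hb
  rw [norm_mul, norm_discMobiusDeriv hb, norm_thullenAutScale, Real.div_rpow (by positivity)
    (by positivity), Real.sqrt_eq_rpow, ← Real.rpow_mul h.le, div_mul_div_comm,
    Real.rpow_add h, Real.rpow_one]
  rw [Real.rpow_add (norm_pos_iff.2 (one_sub_conj_mul_ne_zero hb ht)), Real.rpow_two]
  congr 3
  ring

/-- The function `(Jφ_b · f∘φ_b)²` is holomorphic, and its `L¹` norm over the domain is `‖f‖²` by
the change of variables along `φ_b`. The mean value property on a polydisc about `(a, 0)` bounds its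
value there, where `φ_b` takes the value `z` and `|Jφ_b|² = (1-|b|²)^(2+α)`. -/
theorem enorm_toFun_mul_le (hα : 0 < α) (f : bergmanSpace (thullenDomain α hα))
    (z : thullenDomain α hα) {R S : ℝ} (hR : 0 < R) (hS : 0 < S)
    (hsub : ball (fAlpha α z) R ×ˢ ball 0 S ⊆ (thullenDomain α hα : Set (ℂ × ℂ))) :
    ‖toFun f z‖ₑ ^ 2 * ENNReal.ofReal ((1 - ‖(z : ℂ × ℂ).2‖ ^ 2) ^ (2 + α)) *
      ENNReal.ofReal (R ^ 2) * ENNReal.ofReal (S ^ 2) ≤ ‖f‖ₑ ^ 2 := by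
  obtain ⟨z, hz⟩ := z
  set b := z.2 with hb'
  have hb : ‖b‖ < 1 := norm_snd_lt_one_of_mem_thullenDomain hz
  set J : ℂ × ℂ → ℂ := fun u => discMobiusDeriv b u.2 * thullenAutScale α b u.2 with hJ
  set F : ℂ × ℂ → ℂ := fun u => (J u * toFun f (thullenAut α b u)) ^ 2 with hF
  have hu2 : ∀ u ∈ thullenDomain α hα, ‖u.2‖ < 1 := fun u hu =>
    norm_snd_lt_one_of_mem_thullenDomain hu
  have hs : DifferentiableOn ℂ (fun u : ℂ × ℂ => thullenAutScale α b u.2)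
      (thullenDomain α hα) := fun u hu =>
    ((differentiableAt_thullenAutScale hb (hu2 u hu)).comp u
      differentiableAt_snd).differentiableWithinAt
  have hm : DifferentiableOn ℂ (fun u : ℂ × ℂ => discMobius b u.2) (thullenDomain α hα) :=
    fun u hu => ((hasDerivAt_discMobius hb (hu2 u hu)).differentiableAt.comp u
      differentiableAt_snd).differentiableWithinAt
  have hm' : DifferentiableOn ℂ (fun u : ℂ × ℂ => discMobiusDeriv b u.2) (thullenDomain α hα) := by
    intro u hu
    have h0 := pow_ne_zero 2 (one_sub_conj_mul_ne_zero hb (hu2 u hu))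
    unfold discMobiusDeriv
    exact DifferentiableAt.differentiableWithinAt (by fun_prop (disch := exact h0))
  have hφ : DifferentiableOn ℂ (thullenAut α b) (thullenDomain α hα) := by
    rw [funext (thullenAut_eq (α := α) (b := b))]
    exact (hs.mul differentiableOn_fst).prodMk hm
  have hFd : DifferentiableOn ℂ F (thullenDomain α hα) :=
    ((hm'.mul hs).mul ((differentiableOn_toFun f).comp hφ fun u hu =>
      (thullenAut_mem_iff hα hb (hu2 u hu)).2 hu)).pow 2
  have h1 := enorm_mul_le_lintegral_polydisc (z := (fAlpha α z, 0)) hR hS (hFd.mono hsub)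
  have h2 : ‖F (fAlpha α z, 0)‖ₑ =
      ‖toFun f z‖ₑ ^ 2 * ENNReal.ofReal ((1 - ‖b‖ ^ 2) ^ (2 + α)) := by
    have hp := one_sub_norm_sq_pos hb
    have e : thullenAut α b (fAlpha α z, 0) = z := thullenAut_fAlpha hb
    simp only [hF, hJ, enorm_pow, e]
    rw [enorm_mul, mul_pow, mul_comm, ← ofReal_norm (_ * _),
      norm_discMobiusDeriv_mul_thullenAutScale hb (by simp), ← ENNReal.ofReal_pow (by positivity)]
    congr 2
    rw [mul_zero, sub_zero, norm_one, Real.one_rpow, div_one, ← Real.rpow_natCast,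
      ← Real.rpow_mul hp.le]
    congr 1
    push_cast
    ring
  rw [h2] at h1
  refine h1.trans ((lintegral_mono_set hsub).trans ?_)
  rw [enorm_sq_eq_lintegral]
  have hfm : Measurable
      ((thullenDomain α hα : Set (ℂ × ℂ)).indicator fun w => ‖toFun f w‖ₑ ^ 2) := by
    classical
    rw [← Set.piecewise_eq_indicator]
    exact ((ENNReal.continuous_pow 2).comp_continuousOn
      (differentiableOn_toFun f).continuousOn.enorm).measurable_piecewise
      continuousOn_const (thullenDomain α hα).isOpen.measurableSet
  have h3 := lintegral_thullenDomain_comp_thullenAut hα hb hfm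
  rw [setLIntegral_congr_fun (thullenDomain α hα).isOpen.measurableSet
    (Set.eqOn_indicator (s := (thullenDomain α hα : Set (ℂ × ℂ)))
      (f := fun w => ‖toFun f w‖ₑ ^ 2)).symm, h3]
  refine le_of_eq (setLIntegral_congr_fun (thullenDomain α hα).isOpen.measurableSet fun u hu => ?_)
  rw [Set.indicator_of_mem ((thullenAut_mem_iff hα hb (hu2 u hu)).2 hu), hF, enorm_pow, enorm_mul,
    mul_pow]

/-- Apply the preceding bound to `f = K_z`, for which `K_z(z) = ‖K_z‖²`, and cancel one factor
`‖K_z‖²`. The radii are `R = (1-|a|)/2` and `√(cR)`, so the polydisc contributes `c R³`; since `1 -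
|a|² ≤ 4R`, the constant is `4³ / c`. -/
theorem norm_kernel_sq_mul_le (hα : 0 < α) (z : thullenDomain α hα) :
    ‖kernel z‖ ^ 2 * ((1 - ‖(z : ℂ × ℂ).2‖ ^ 2) ^ (2 + α) * (1 - ‖fAlpha α z‖ ^ 2) ^ 3) ≤
      64 / min 1 (1 / α) := by
  have hb := norm_snd_lt_one_of_mem_thullenDomain z.2
  have ha := norm_fAlpha_lt_one z.2
  set a := fAlpha α z
  set c := min 1 (1 / α) with hc
  have hc0 : 0 < c := by positivity
  set R := (1 - ‖a‖) / 2 with hR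
  have hR0 : 0 < R := by rw [hR]; linarith
  have hcR : 0 < c * R := by positivity
  -- On the first disc `|x| < 1 - R`, so `1 - |x|^(2/α) ≥ c (1 - |x|²) ≥ cR`, which leaves room for
  -- `|y|² < cR`.
  have hsub : ball a R ×ˢ ball 0 (Real.sqrt (c * R)) ⊆ (thullenDomain α hα : Set (ℂ × ℂ)) := by
    rintro ⟨x, y⟩ ⟨hx, hy⟩
    have hx1 : ‖x‖ < 1 - R := by
      rw [mem_ball, dist_eq_norm] at hx
      have := norm_sub_norm_le x a
      rw [hR] at hx ⊢
      linarith
    have hx2 : ‖x‖ < 1 := by linarith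
    rw [mem_ball_zero_iff] at hy
    have hy1 : ‖y‖ ^ 2 < c * R := by
      rw [← Real.sq_sqrt hcR.le]
      gcongr
    have h := min_mul_one_sub_norm_sq_le hα hx2
    rw [← hc] at h
    have h' : c * R ≤ c * (1 - ‖x‖ ^ 2) := by
      gcongr
      nlinarith [norm_nonneg x]
    exact show ‖x‖ ^ (2 / α) + ‖y‖ ^ 2 < 1 by linarith
  have h := enorm_toFun_mul_le hα (kernel z) z hR0 (Real.sqrt_pos.2 hcR) hsub
  have hP : 0 < (1 - ‖(z : ℂ × ℂ).2‖ ^ 2) ^ (2 + α) :=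
    Real.rpow_pos_of_pos (one_sub_norm_sq_pos hb) _
  set P := (1 - ‖(z : ℂ × ℂ).2‖ ^ 2) ^ (2 + α)
  rw [Real.sq_sqrt hcR.le, ← ofReal_norm, ← ofReal_norm (kernel z), ← norm_kernel_sq,
    ← ENNReal.ofReal_pow (by positivity), ← ENNReal.ofReal_pow (by positivity),
    ← ENNReal.ofReal_mul (by positivity), ← ENNReal.ofReal_mul (by positivity),
    ← ENNReal.ofReal_mul (by positivity), ENNReal.ofReal_le_ofReal_iff (by positivity)] at h
  set K := ‖kernel z‖ ^ 2
  have hK : 0 ≤ K := by positivity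
  have h5 : K * P * (c * R ^ 3) ≤ 1 := by
    rcases hK.eq_or_lt with h0 | h0
    · rw [← h0]; simp
    · have : K * (K * P * (c * R ^ 3)) ≤ K * 1 := by nlinarith
      exact le_of_mul_le_mul_left this h0
  have h6 : (1 - ‖a‖ ^ 2) ^ 3 ≤ 64 * R ^ 3 := by
    have h7 : 1 - ‖a‖ ^ 2 ≤ 4 * R := by rw [hR]; nlinarith [norm_nonneg a]
    have := pow_le_pow_left₀ (one_sub_norm_sq_pos ha).le h7 3
    nlinarith
  rw [le_div_iff₀ hc0]
  calc _ ≤ K * (P * (64 * R ^ 3)) * c := by gcongr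
    _ ≤ _ := by linarith

end KernelBound

/-! ### Uniform bounds for two singular integrals on the disc -/

theorem ENNReal.rpow_neg_le_rpow_neg {x y : ℝ≥0∞} {s : ℝ} (h : x ≤ y) (hs : 0 ≤ s) :
    y ^ (-s) ≤ x ^ (-s) := by
  rw [ENNReal.rpow_neg, ENNReal.rpow_neg]
  exact ENNReal.inv_le_inv.2 (ENNReal.rpow_le_rpow h hs)

theorem setLIntegral_ball_enorm_rpow_neg_lt_top {E : Type*} [NormedAddCommGroup E]
    [NormedSpace ℝ E] [FiniteDimensional ℝ E] [MeasurableSpace E] [BorelSpace E] (μ : Measure E)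
    [μ.IsAddHaarMeasure] {s : ℝ} (hd : 1 ≤ Module.finrank ℝ E) (hs : s < Module.finrank ℝ E)
    (r : ℝ) : ∫⁻ x in ball (0 : E) r, ‖x‖ₑ ^ (-s) ∂μ < ∞ := by
  have : Nontrivial E := Module.nontrivial_of_finrank_pos (R := ℝ) (by positivity)
  have h : IntegrableOn (fun x : E => ‖x‖ ^ (-s)) (ball 0 r) μ :=
    integrableOn_ball_of_norm_le_rpow hd hs (C := 1)
      (Eventually.of_forall fun x => by
        rw [Real.norm_of_nonneg (by positivity), one_mul])
      (Measurable.aestronglyMeasurable (by fun_prop))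
  refine lt_of_eq_of_lt (lintegral_congr_ae ?_) h.2
  have h0 : ∀ᵐ x ∂μ.restrict (ball (0 : E) r), x ≠ 0 :=
    ae_restrict_of_ae (by simp [ae_iff])
  filter_upwards [h0] with x hx
  rw [Real.enorm_of_nonneg (by positivity), ← ofReal_norm,
    ENNReal.ofReal_rpow_of_pos (norm_pos_iff.2 hx)]

/-- After translation by `a` the unit disc sits inside the disc of radius `2` about the singularity,
which makes the bound independent of `a`. -/
theorem exists_setLIntegral_ball_enorm_sub_rpow_neg_le {s : ℝ} (hs : s < 2) :
    ∃ C : ℝ≥0∞, C ≠ ∞ ∧ ∀ a : ℂ, ‖a‖ < 1 →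
      ∫⁻ u in ball (0 : ℂ) 1, ‖u - a‖ₑ ^ (-s) ≤ C := by
  refine ⟨_, (setLIntegral_ball_enorm_rpow_neg_lt_top (volume : Measure ℂ) (s := s) (by simp)
    (by simpa using hs) 2).ne, fun a ha => ?_⟩
  rw [← lintegral_indicator measurableSet_ball, ← lintegral_indicator measurableSet_ball,
    ← lintegral_sub_right_eq_self ((ball (0 : ℂ) 2).indicator fun u => ‖u‖ₑ ^ (-s)) a]
  refine lintegral_mono fun u => ?_
  by_cases hu : u ∈ ball (0 : ℂ) 1
  · rw [Set.indicator_of_mem hu, Set.indicator_of_mem]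
    rw [mem_ball_zero_iff] at hu ⊢
    linarith [norm_sub_le u a]
  · rw [Set.indicator_of_notMem hu]
    exact zero_le

/-- With `t = (θ/π)² ≤ 1` one has `1 - cos θ ≥ 2t`, so the squared modulus `(1-r)² + 2r(1 - cos θ)`
is at least `(1-r)² + 4rt ≥ t (1+r)² ≥ t`. -/
theorem inv_pi_mul_abs_le_norm_one_sub_mul_exp {r θ : ℝ} (hr0 : 0 ≤ r)
    (hθ : |θ| ≤ Real.pi) : Real.pi⁻¹ * |θ| ≤ ‖1 - r * Complex.exp (θ * Complex.I)‖ := by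
  refine le_of_sq_le_sq ?_ (norm_nonneg _)
  have h1 : ‖1 - r * Complex.exp (θ * Complex.I)‖ ^ 2 = (1 - r) ^ 2 + 2 * r * (1 - Real.cos θ) := by
    rw [← Complex.normSq_eq_norm_sq, Complex.normSq_apply, Complex.exp_mul_I]
    simp [Complex.cos_ofReal_re, Complex.sin_ofReal_re, Complex.cos_ofReal_im,
      Complex.sin_ofReal_im]
    linear_combination r ^ 2 * Real.sin_sq_add_cos_sq θ
  have h2 := Real.cos_le_one_sub_mul_cos_sq hθ
  set t := (Real.pi⁻¹ * |θ|) ^ 2 with ht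
  have h3 : 2 / Real.pi ^ 2 * θ ^ 2 = 2 * t := by
    rw [ht, mul_pow, sq_abs, inv_pow]
    ring
  have h4 : t ≤ 1 := by
    rw [ht]
    refine pow_le_one₀ (by positivity) ?_
    rw [inv_mul_le_iff₀ Real.pi_pos, mul_one]
    exact hθ
  have h5 : 0 ≤ t := by positivity
  rw [h1]
  nlinarith [mul_nonneg hr0 (sub_nonneg.2 h2), mul_nonneg hr0 h5,
    mul_nonneg (sub_nonneg.2 h4) (sq_nonneg (1 - r)), mul_nonneg h5 (sq_nonneg r)]

/-- In polar coordinates the singularities decouple: the first factor is at most `(|θ|/π)^(-s)`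
whatever the radius, and the second at most `(1-r)^(-τ)`. Each is integrable in one dimension as `s,
τ < 1`, uniformly up to `|b| = 1`. -/
theorem exists_setLIntegral_ball_one_sub_mul_rpow_le {s τ : ℝ} (hs0 : 0 ≤ s) (hs1 : s < 1)
    (hτ0 : 0 ≤ τ) (hτ1 : τ < 1) :
    ∃ C : ℝ≥0∞, C ≠ ∞ ∧ ∀ b : ℂ, ‖b‖ ≤ 1 → ∫⁻ ζ in ball (0 : ℂ) 1,
      ‖1 - b * ζ‖ₑ ^ (-s) * ENNReal.ofReal (1 - ‖ζ‖ ^ 2) ^ (-τ) ≤ C := by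
  set C₁ := ∫⁻ θ in ball (0 : ℝ) Real.pi, (ENNReal.ofReal Real.pi⁻¹ * ‖θ‖ₑ) ^ (-s) with hC₁
  set C₂ := ∫⁻ r in ball (0 : ℝ) 1, ‖r‖ₑ ^ (-τ) with hC₂
  have hC₂t : C₂ ≠ ∞ := (setLIntegral_ball_enorm_rpow_neg_lt_top (volume : Measure ℝ) (s := τ)
    (by simp) (by simpa using hτ1) 1).ne
  have hC₁t : C₁ ≠ ∞ := by
    have h : ∀ θ : ℝ, (ENNReal.ofReal Real.pi⁻¹ * ‖θ‖ₑ) ^ (-s) =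
        ENNReal.ofReal Real.pi⁻¹ ^ (-s) * ‖θ‖ₑ ^ (-s) := fun θ =>
      ENNReal.mul_rpow_of_ne_top (by simp) (by simp) _
    have h' : ENNReal.ofReal Real.pi⁻¹ ^ (-s) ≠ ∞ :=
      ENNReal.rpow_ne_top_of_ne_zero (by simp [Real.pi_pos]) (by simp)
    rw [hC₁]
    simp_rw [h]
    rw [lintegral_const_mul' _ _ h']
    exact ENNReal.mul_ne_top h' (setLIntegral_ball_enorm_rpow_neg_lt_top (volume : Measure ℝ)
      (s := s) (by simp) (by simpa using hs1) Real.pi).ne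
  refine ⟨C₂ * C₁, ENNReal.mul_ne_top hC₂t hC₁t, fun b hb => ?_⟩
  -- A rotation reduces to real `b ≥ 0`.
  obtain ⟨u, hu, hub⟩ : ∃ u : ℂ, ‖u‖ = 1 ∧ b * u = (‖b‖ : ℂ) := by
    rcases eq_or_ne b 0 with rfl | hb0
    · exact ⟨1, by simp, by simp⟩
    · have h0 : (‖b‖ : ℂ) ≠ 0 := by exact_mod_cast norm_ne_zero_iff.2 hb0
      refine ⟨‖b‖ / b, ?_, by field_simp⟩
      rw [norm_div, Complex.norm_real, norm_norm, div_self (norm_ne_zero_iff.2 hb0)]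
  set g : ℂ → ℝ≥0∞ := fun ζ =>
    ‖1 - b * ζ‖ₑ ^ (-s) * ENNReal.ofReal (1 - ‖ζ‖ ^ 2) ^ (-τ) with hg
  have hu0 : u ≠ 0 := by rw [← norm_ne_zero_iff, hu]; exact one_ne_zero
  have hu1 : ‖u‖ₑ = 1 := by rw [← ofReal_norm, hu, ENNReal.ofReal_one]
  rw [← lintegral_indicator measurableSet_ball, lintegral_eq_lintegral_comp_mul_left hu0, hu1]
  simp only [one_pow, one_mul]
  rw [← Complex.lintegral_comp_polarCoord_symm, polarCoord_target, Measure.volume_eq_prod,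
    ← Measure.prod_restrict]
  have hgm : Measurable g := by fun_prop
  have hsym : Measurable Complex.polarCoord.symm := by
    have : (Complex.polarCoord.symm : ℝ × ℝ → ℂ) =
        fun p => p.1 * (Real.cos p.2 + Real.sin p.2 * Complex.I) :=
      funext Complex.polarCoord_symm_apply
    rw [this]
    fun_prop
  rw [lintegral_prod _ (by
    have := hgm.indicator (measurableSet_ball (x := (0 : ℂ)) (ε := 1))
    exact Measurable.aemeasurable (by simp only [smul_eq_mul]; fun_prop))]
  have hpt : ∀ r ∈ Set.Ioi (0 : ℝ), ∀ θ ∈ Set.Ioo (-Real.pi) Real.pi,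
      ENNReal.ofReal r • (ball (0 : ℂ) 1).indicator g (u * Complex.polarCoord.symm (r, θ)) ≤
        (ball (0 : ℝ) 1).indicator (fun r => ‖r‖ₑ ^ (-τ)) (1 - r) *
          (ENNReal.ofReal Real.pi⁻¹ * ‖θ‖ₑ) ^ (-s) := by
    intro r hr θ hθ
    have hr0 : 0 < r := hr
    have hpol : Complex.polarCoord.symm (r, θ) = r * Complex.exp (θ * Complex.I) := by
      rw [Complex.polarCoord_symm_apply, Complex.exp_mul_I]
      push_cast
      rfl
    have hn : ‖u * Complex.polarCoord.symm (r, θ)‖ = r := by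
      rw [hpol, norm_mul, hu, norm_mul, Complex.norm_exp_ofReal_mul_I, Complex.norm_real,
        Real.norm_of_nonneg hr0.le, one_mul, mul_one]
    by_cases hr1 : r < 1
    · rw [Set.indicator_of_mem (by rwa [mem_ball_zero_iff, hn]), Set.indicator_of_mem (by
        rw [mem_ball_zero_iff, Real.norm_eq_abs, abs_of_pos (by linarith)]
        linarith), smul_eq_mul, hg]
      dsimp only
      rw [hn, ← mul_assoc b, hub, hpol, ← mul_assoc]
      have h1 : ENNReal.ofReal r ≤ 1 := by
        rw [← ENNReal.ofReal_one]
        exact ENNReal.ofReal_le_ofReal hr1.le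
      have h2 := inv_pi_mul_abs_le_norm_one_sub_mul_exp (r := ‖b‖ * r) (θ := θ) (by positivity)
        (abs_le.2 ⟨hθ.1.le, hθ.2.le⟩)
      calc _ ≤ 1 * (ENNReal.ofReal Real.pi⁻¹ * ‖θ‖ₑ) ^ (-s) * ‖1 - r‖ₑ ^ (-τ) := by
            refine mul_le_mul' (mul_le_mul' h1 (ENNReal.rpow_neg_le_rpow_neg ?_ hs0))
              (ENNReal.rpow_neg_le_rpow_neg ?_ hτ0)
            · rw [← ofReal_norm, ← ofReal_norm (_ - _), ← ENNReal.ofReal_mul (by positivity)]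
              refine ENNReal.ofReal_le_ofReal (h2.trans_eq ?_)
              push_cast
              ring_nf
            · rw [Real.enorm_of_nonneg (by linarith)]
              exact ENNReal.ofReal_le_ofReal (by nlinarith)
        _ = _ := by rw [one_mul, mul_comm]
    · rw [Set.indicator_of_notMem (by rwa [mem_ball_zero_iff, hn]), smul_zero]
      exact zero_le
  calc _ ≤ ∫⁻ r in Set.Ioi (0 : ℝ), ∫⁻ θ in Set.Ioo (-Real.pi) Real.pi,
        (ball (0 : ℝ) 1).indicator (fun r => ‖r‖ₑ ^ (-τ)) (1 - r) *
          (ENNReal.ofReal Real.pi⁻¹ * ‖θ‖ₑ) ^ (-s) :=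
        setLIntegral_mono' measurableSet_Ioi fun r hr =>
          setLIntegral_mono' measurableSet_Ioo fun θ hθ => hpt r hr θ hθ
    _ = ∫⁻ r in Set.Ioi (0 : ℝ), (ball (0 : ℝ) 1).indicator (fun r => ‖r‖ₑ ^ (-τ)) (1 - r) * C₁ := by
        refine lintegral_congr fun r => ?_
        rw [lintegral_const_mul _ (by fun_prop), hC₁, Real.ball_eq_Ioo 0 Real.pi, zero_sub, zero_add]
    _ ≤ ∫⁻ r, (ball (0 : ℝ) 1).indicator (fun r => ‖r‖ₑ ^ (-τ)) (1 - r) * C₁ :=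
        setLIntegral_le_lintegral _ _
    _ = C₂ * C₁ := by
        rw [lintegral_mul_const' _ _ hC₁t, lintegral_sub_left_eq_self
          ((ball (0 : ℝ) 1).indicator (fun r => ‖r‖ₑ ^ (-τ))) 1,
          lintegral_indicator measurableSet_ball]

/-! ### Pointwise majorant of the weighted Jacobian -/

/-- Here the letters stand for logarithms (except `q`, `α`), so monomial inequalities become linear
and the claim is a nonnegative combination of the hypotheses. The signs of the coefficients are
where `1 ≤ q ≤ 4/3` enters. The exponent of `M` splits into `q/2 - 2/3`, paid for by `Y ≤ M`, and
`-qα/2`, paid for by `μ^(2/α) ≤ M`; the second produces `μ^(-q)`. Bounding `ρm`, `ρu` and `L` leaves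
`n^(-3q/2)`, and `μ n = d ≤ n` merges the two into `d^(-3q/2)`. -/
theorem weighted_jacobian_log_le {q α lc₁ lc₂ l₂ p N M Y ρm ρu A L n μ d : ℝ} (hq1 : 1 ≤ q)
    (hq2 : q ≤ 4 / 3) (hα : 0 < α) (h1 : Y ≤ M) (h2 : μ * (2 / α) ≤ M) (h3 : μ + n = d)
    (h4 : lc₁ + (A + L - 2 * n) ≤ ρm) (h5 : ρu ≤ lc₂ + L) (h6 : L ≤ l₂ + n) (h7 : d ≤ n) :
    p / 3 - 2 / 3 * N + (q / 2 - q * α / 2 - 2 / 3) * M - (3 / 2 * q - 1) * (ρm + Y) +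
        q * (A - 2 * n) + q / 2 * (ρm - ρu) ≤
      (1 - q) * lc₁ + (1 - q / 2) * lc₂ + (2 - 3 / 2 * q) * l₂ + p / 3 + A - 2 / 3 * N -
        (q - 1 / 3) * Y - ρu - 3 / 2 * q * d := by
  have e2 : q * α / 2 * (μ * (2 / α)) = q * μ := by field_simp
  have i1 := mul_le_mul_of_nonneg_left h1 (show 0 ≤ 2 / 3 - q / 2 by linarith)
  have i2 := mul_le_mul_of_nonneg_left h2 (show 0 ≤ q * α / 2 by positivity)
  have i4 := mul_le_mul_of_nonneg_left h4 (show 0 ≤ q - 1 by linarith)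
  have i5 := mul_le_mul_of_nonneg_left h5 (show 0 ≤ 1 - q / 2 by linarith)
  have i6 := mul_le_mul_of_nonneg_left h6 (show 0 ≤ 2 - 3 / 2 * q by linarith)
  have i7 := mul_le_mul_of_nonneg_left h7 (show 0 ≤ q / 2 by linarith)
  rw [e2] at i2
  subst h3
  linarith

/-- Dictionary, with `v = ϕ_a(u)` and `m = v₁`: `P = 1-|b|²`, `N = |1 - b̄ v₂|`, `M = 1-|v₂|²`, `Y =
1 - |u₂|²/ρu`, `ρm = 1-|m|^(2/α)`, `ρu = 1-|u₁|^(2/α)`, `A = 1-|a|²`, `L = 1-|u₁|²`, `n = |1 - ā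
u₁|`, `μ = |m|`, `d = |u₁ - a|`. The exponents of the weight are such that `P` and `N` end up with
powers `1/3` and `-2/3` for every `q`. -/
theorem weighted_jacobian_rpow_le {q α c₁ c₂ P N M Y ρm ρu A L n μ d : ℝ} (hq1 : 1 ≤ q)
    (hq2 : q ≤ 4 / 3) (hα : 0 < α) (hc₁ : 0 < c₁) (hc₂ : 0 < c₂) (hP : 0 < P) (hN : 0 < N)
    (hM : 0 < M) (hY : 0 < Y) (hρm : 0 < ρm) (hρu : 0 < ρu) (hA : 0 < A) (hL : 0 < L)
    (hn : 0 < n) (hμ : 0 < μ) (hd : 0 < d) (h1 : Y ≤ M) (h2 : μ ^ (2 / α) ≤ M)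
    (h3 : μ * n = d) (h4 : c₁ * (A * L / n ^ (2 : ℝ)) ≤ ρm) (h5 : ρu ≤ c₂ * L) (h6 : L ≤ 2 * n)
    (h7 : d ≤ n) :
    (A / n ^ (2 : ℝ) * (ρm / ρu) ^ (1 / 2 : ℝ) * (P ^ (1 + α / 2) / N ^ (2 + α)) *
        ((P * M / N ^ (2 : ℝ)) ^ (1 / 2 - α / 2 - 2 / (3 * q)) *
          (P / N ^ (2 : ℝ) * (ρm * Y)) ^ (-(3 / 2 - 1 / q)))) ^ q ≤
      c₁ ^ (1 - q) * c₂ ^ (1 - q / 2) * 2 ^ (2 - 3 / 2 * q) * (P ^ (1 / 3 : ℝ) * A) *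
        (d ^ (-(3 / 2 * q)) * ρu⁻¹ * (N ^ (-(2 / 3 : ℝ)) * Y ^ (-(q - 1 / 3)))) := by
  have hex : ∀ {x : ℝ}, 0 < x → ∃ y, Real.exp y = x := fun hx => ⟨_, Real.exp_log hx⟩
  have h20 : (0 : ℝ) < 2 := two_pos
  obtain ⟨lc₁, rfl⟩ := hex hc₁
  obtain ⟨lc₂, rfl⟩ := hex hc₂
  obtain ⟨P, rfl⟩ := hex hP
  obtain ⟨N, rfl⟩ := hex hN
  obtain ⟨M, rfl⟩ := hex hM
  obtain ⟨Y, rfl⟩ := hex hY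
  obtain ⟨ρm, rfl⟩ := hex hρm
  obtain ⟨ρu, rfl⟩ := hex hρu
  obtain ⟨A, rfl⟩ := hex hA
  obtain ⟨L, rfl⟩ := hex hL
  obtain ⟨n, rfl⟩ := hex hn
  obtain ⟨μ, rfl⟩ := hex hμ
  obtain ⟨d, rfl⟩ := hex hd
  have e2 : ∀ t : ℝ, (2 : ℝ) ^ t = Real.exp (Real.log 2 * t) := fun t =>
    Real.rpow_def_of_pos h20 t
  rw [← Real.exp_log h20] at h6
  rw [e2 (2 - 3 / 2 * q)]
  simp only [← Real.exp_mul, ← Real.exp_add, ← Real.exp_sub, ← Real.exp_neg, Real.exp_le_exp,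
    Real.exp_eq_exp] at h1 h2 h3 h4 h5 h6 h7 ⊢
  have key := weighted_jacobian_log_le (p := P) (N := N) hq1 hq2 hα h1 h2 h3 (A := A) (L := L)
    (ρm := ρm) (lc₁ := lc₁) (by linarith) h5 h6 h7
  have hq0 : q ≠ 0 := by positivity
  refine (le_of_eq ?_).trans (key.trans (le_of_eq ?_))
  · field_simp
    ring
  · ring

/-- The weight used in Schur's test on the Thullen domain. -/
noncomputable def thullenWeight (α q : ℝ) (w : ℂ × ℂ) : ℝ :=
  (1 - ‖w.2‖ ^ 2) ^ (1 / 2 - α / 2 - 2 / (3 * q)) *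
    (1 - ‖w.1‖ ^ (2 / α) - ‖w.2‖ ^ 2) ^ (-(3 / 2 - 1 / q))

theorem measurable_thullenWeight (α q : ℝ) : Measurable (thullenWeight α q) := by
  unfold thullenWeight
  fun_prop

theorem thullenWeight_pos {α q : ℝ} {hα : 0 < α} {w : ℂ × ℂ} (hw : w ∈ thullenDomain α hα) :
    0 < thullenWeight α q w := by
  have h1 := one_sub_norm_sq_pos (norm_snd_lt_one_of_mem_thullenDomain hw)
  have h2 : 0 < 1 - ‖w.1‖ ^ (2 / α) - ‖w.2‖ ^ 2 := by
    rw [mem_thullenDomain] at hw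
    linarith
  exact mul_pos (Real.rpow_pos_of_pos h1 _) (Real.rpow_pos_of_pos h2 _)

section Pointwise

variable {α : ℝ} {a b : ℂ}

theorem thullenWeight_thullenAut (hα : 0 < α) (hb : ‖b‖ < 1) (q : ℝ) {w : ℂ × ℂ}
    (hw : ‖w.2‖ < 1) :
    thullenWeight α q (thullenAut α b w) =
      ((1 - ‖b‖ ^ 2) * (1 - ‖w.2‖ ^ 2) / ‖1 - conj b * w.2‖ ^ 2) ^
          (1 / 2 - α / 2 - 2 / (3 * q)) *
        ((1 - ‖b‖ ^ 2) / ‖1 - conj b * w.2‖ ^ 2 * (1 - ‖w.1‖ ^ (2 / α) - ‖w.2‖ ^ 2)) ^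
          (-(3 / 2 - 1 / q)) := by
  rw [thullenWeight, thullenAut_defining hα hb hw, ← one_sub_norm_discMobius_sq hb hw,
    thullenAut_eq]

theorem norm_jacobian_mul_thullenWeight_rpow_le {q : ℝ} (hq1 : 1 ≤ q) (hq2 : q ≤ 4 / 3)
    {hα : 0 < α} (ha : ‖a‖ < 1) (hb : ‖b‖ < 1) {u : ℂ × ℂ} (hu : u ∈ thullenDomain α hα)
    (hua : u.1 ≠ a) :
    (‖discMobiusDeriv a u.1 * thullenMapScale α a u.1‖ *
        ‖discMobiusDeriv b (thullenMap α a u).2 * thullenAutScale α b (thullenMap α a u).2‖ *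
        thullenWeight α q (thullenAut α b (thullenMap α a u))) ^ q ≤
      min 1 (1 / α) ^ (1 - q) * max 1 (1 / α) ^ (1 - q / 2) * 2 ^ (2 - 3 / 2 * q) *
        ((1 - ‖b‖ ^ 2) ^ (1 / 3 : ℝ) * (1 - ‖a‖ ^ 2)) *
        (‖u.1 - a‖ ^ (-(3 / 2 * q)) * (1 - ‖u.1‖ ^ (2 / α))⁻¹ *
          (‖1 - conj b * (thullenMapScale α a u.1 * u.2)‖ ^ (-(2 / 3 : ℝ)) *
            (1 - ‖u.2‖ ^ 2 / (1 - ‖u.1‖ ^ (2 / α))) ^ (-(q - 1 / 3)))) := by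
  have hu1 := norm_fst_lt_one_of_mem_thullenDomain hu
  have hv := (thullenMap_mem_iff hα ha hu1).2 hu
  have hv2 := norm_snd_lt_one_of_mem_thullenDomain hv
  have hm := norm_discMobius_lt_one ha hu1
  have hρu := one_sub_norm_rpow_pos hα hu1
  have hρm := one_sub_norm_rpow_pos hα hm
  have hn := norm_pos_iff.2 (one_sub_conj_mul_ne_zero ha hu1)
  have hd : 0 < ‖u.1 - a‖ := norm_pos_iff.2 (sub_ne_zero.2 hua)
  have hdn : ‖discMobius a u.1‖ * ‖1 - conj a * u.1‖ = ‖u.1 - a‖ := by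
    rw [discMobius, norm_div, div_mul_cancel₀ _ hn.ne', norm_sub_rev]
  have hμ : 0 < ‖discMobius a u.1‖ := by
    by_contra! h
    nlinarith
  set v := thullenMap α a u with hv'
  have hvc : v = (discMobius a u.1, thullenMapScale α a u.1 * u.2) := thullenMap_eq u
  have hY : 0 < 1 - ‖u.2‖ ^ 2 / (1 - ‖u.1‖ ^ (2 / α)) := by
    rw [sub_pos, div_lt_one hρu]
    rw [mem_thullenDomain] at hu
    linarith
  have hv2sq : ‖v.2‖ ^ 2 =
      (1 - ‖discMobius a u.1‖ ^ (2 / α)) * (‖u.2‖ ^ 2 / (1 - ‖u.1‖ ^ (2 / α))) := by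
    rw [hvc]
    dsimp only
    rw [norm_mul, mul_pow, norm_thullenMapScale_sq hα ha hu1]
    ring
  have hy0 : 0 ≤ ‖u.2‖ ^ 2 / (1 - ‖u.1‖ ^ (2 / α)) := by positivity
  have hX0 : 0 ≤ ‖discMobius a u.1‖ ^ (2 / α) := by positivity
  have hs : ‖thullenMapScale α a u.1‖ =
      ((1 - ‖discMobius a u.1‖ ^ (2 / α)) / (1 - ‖u.1‖ ^ (2 / α))) ^ (1 / 2 : ℝ) := by
    rw [← norm_thullenMapScale_sq hα ha hu1, ← Real.sqrt_eq_rpow, Real.sqrt_sq (norm_nonneg _)]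
  have hdef : 1 - ‖v.1‖ ^ (2 / α) - ‖v.2‖ ^ 2 = (1 - ‖discMobius a u.1‖ ^ (2 / α)) *
      (1 - ‖u.2‖ ^ 2 / (1 - ‖u.1‖ ^ (2 / α))) := by
    rw [hv2sq, hvc]
    ring
  have key := weighted_jacobian_rpow_le hq1 hq2 hα (c₁ := min 1 (1 / α)) (c₂ := max 1 (1 / α))
    (by positivity) (by positivity) (one_sub_norm_sq_pos hb)
    (norm_pos_iff.2 (one_sub_conj_mul_ne_zero hb hv2)) (one_sub_norm_sq_pos hv2) hY hρm hρu
    (one_sub_norm_sq_pos ha) (one_sub_norm_sq_pos hu1) hn hμ hd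
    (by rw [hv2sq]; nlinarith) (by rw [hv2sq]; nlinarith) hdn
    (by
      rw [Real.rpow_two, ← one_sub_norm_discMobius_sq ha hu1]
      exact min_mul_one_sub_norm_sq_le hα hm)
    (one_sub_norm_rpow_le_max_mul hα hu1)
    (by nlinarith [one_sub_norm_le_norm_one_sub_conj_mul ha u.1, norm_nonneg u.1])
    (by rw [← hdn]; nlinarith)
  rw [norm_mul, norm_discMobiusDeriv ha, hs, norm_discMobiusDeriv_mul_thullenAutScale hb hv2,
    thullenWeight_thullenAut hα hb q hv2, hdef]
  have e : thullenMapScale α a u.1 * u.2 = v.2 := by rw [hvc]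
  rw [e]
  simpa only [Real.rpow_two] using key

end Pointwise

/-! ### Integration of the majorant -/

section Integrals

variable {α : ℝ} {a b : ℂ}

theorem thullenDomain_mem_iff_mem_ball {hα : 0 < α} {x y : ℂ} :
    (x, y) ∈ thullenDomain α hα ↔ y ∈ ball (0 : ℂ) (Real.sqrt (1 - ‖x‖ ^ (2 / α))) := by
  rw [mem_thullenDomain, mem_ball_zero_iff, Real.lt_sqrt (norm_nonneg _), lt_sub_iff_add_lt']

/-- Over each `u₁` rescale the fibre by `u₂ = √ρ ζ` with `ρ = 1-|u₁|^(2/α)`. The area factor `ρ`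
cancels `ρ⁻¹`, the fibre integral is then bounded by `C₂` whatever `u₁` is, and only the singularity
at `a` remains. -/
theorem lintegral_jacobian_majorant_le (hα : 0 < α) {C₁ C₂ : ℝ≥0∞} {s σ τ : ℝ}
    (h₁ : ∀ a : ℂ, ‖a‖ < 1 → ∫⁻ u in ball (0 : ℂ) 1, ‖u - a‖ₑ ^ (-s) ≤ C₁)
    (h₂ : ∀ b : ℂ, ‖b‖ ≤ 1 → ∫⁻ ζ in ball (0 : ℂ) 1,
      ‖1 - b * ζ‖ₑ ^ (-σ) * ENNReal.ofReal (1 - ‖ζ‖ ^ 2) ^ (-τ) ≤ C₂) (hC₂ : C₂ ≠ ∞)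
    (ha : ‖a‖ < 1) (hb : ‖b‖ < 1) :
    ∫⁻ u : ℂ × ℂ in thullenDomain α hα, ‖u.1 - a‖ₑ ^ (-s) *
      ((ENNReal.ofReal (1 - ‖u.1‖ ^ (2 / α)))⁻¹ *
        (‖1 - conj b * (thullenMapScale α a u.1 * u.2)‖ₑ ^ (-σ) *
          ENNReal.ofReal (1 - ‖u.2‖ ^ 2 / (1 - ‖u.1‖ ^ (2 / α))) ^ (-τ))) ≤ C₁ * C₂ := by
  have hcm := measurable_thullenMapScale α a
  rw [setLIntegral_thullenDomain_eq hα (by fun_prop)]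
  calc _ ≤ ∫⁻ x in ball (0 : ℂ) 1, ‖x - a‖ₑ ^ (-s) * C₂ := by
        refine setLIntegral_mono' measurableSet_ball fun x hx => ?_
        rw [mem_ball_zero_iff] at hx
        have hρ := one_sub_norm_rpow_pos hα hx
        set ρ := 1 - ‖x‖ ^ (2 / α) with hρ'
        set c := thullenMapScale α a x with hc
        have hind : ∀ y, (thullenDomain α hα : Set (ℂ × ℂ)).indicator (fun u : ℂ × ℂ =>
            ‖u.1 - a‖ₑ ^ (-s) * ((ENNReal.ofReal (1 - ‖u.1‖ ^ (2 / α)))⁻¹ *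
              (‖1 - conj b * (thullenMapScale α a u.1 * u.2)‖ₑ ^ (-σ) *
                ENNReal.ofReal (1 - ‖u.2‖ ^ 2 / (1 - ‖u.1‖ ^ (2 / α))) ^ (-τ)))) (x, y) =
            ‖x - a‖ₑ ^ (-s) * ((ENNReal.ofReal ρ)⁻¹ * (ball (0 : ℂ) (Real.sqrt ρ)).indicator
              (fun y => ‖1 - conj b * (c * y)‖ₑ ^ (-σ) *
                ENNReal.ofReal (1 - ‖y‖ ^ 2 / ρ) ^ (-τ)) y) := fun y => by
          by_cases hy : (x, y) ∈ thullenDomain α hα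
          · rw [Set.indicator_of_mem (thullenDomain_mem_iff_mem_ball.1 hy), Set.indicator_of_mem hy]
          · rw [Set.indicator_of_notMem (mt thullenDomain_mem_iff_mem_ball.2 hy),
              Set.indicator_of_notMem hy, mul_zero, mul_zero]
        have hm : Measurable fun y : ℂ => (ball (0 : ℂ) (Real.sqrt ρ)).indicator
              (fun y => ‖1 - conj b * (c * y)‖ₑ ^ (-σ) *
                ENNReal.ofReal (1 - ‖y‖ ^ 2 / ρ) ^ (-τ)) y :=
          Measurable.indicator (by fun_prop) measurableSet_ball
        simp_rw [hind]
        rw [lintegral_const_mul _ (hm.const_mul _), lintegral_const_mul _ hm,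
          lintegral_indicator measurableSet_ball,
          setLIntegral_ball_eq_lintegral_ball_one (Real.sqrt_pos.2 hρ), Real.sq_sqrt hρ.le,
          ← mul_assoc (_⁻¹), ENNReal.inv_mul_cancel (by simpa using hρ) (by simp), one_mul]
        gcongr
        refine (le_of_eq ?_).trans (h₂ (conj b * (c * Real.sqrt ρ)) ?_)
        · refine lintegral_congr fun ζ => ?_
          congr 2
          · ring_nf
          · rw [norm_mul, mul_pow, Complex.norm_real, Real.norm_of_nonneg (Real.sqrt_nonneg _),
              Real.sq_sqrt hρ.le, mul_div_cancel_left₀ _ hρ.ne']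
        -- `|c|² ρ = 1 - |m|^(2/α)` by the choice of the scale.
        · have h : ‖c * Real.sqrt ρ‖ ≤ 1 := by
            refine le_of_sq_le_sq ?_ zero_le_one
            rw [norm_mul, mul_pow, hc, norm_thullenMapScale_sq hα ha hx, Complex.norm_real,
              Real.norm_of_nonneg (Real.sqrt_nonneg _), Real.sq_sqrt hρ.le,
              div_mul_cancel₀ _ hρ.ne']
            have : 0 ≤ ‖discMobius a x‖ ^ (2 / α) := by positivity
            linarith
          rw [norm_mul, RCLike.norm_conj]
          exact mul_le_one₀ hb.le (norm_nonneg _) h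
    _ ≤ C₁ * C₂ := by
        rw [lintegral_mul_const' _ _ hC₂]
        gcongr
        exact h₁ a ha

theorem exists_lintegral_jacobian_mul_thullenWeight_rpow_le (hα : 0 < α) {q : ℝ} (hq1 : 1 ≤ q)
    (hq2 : q < 4 / 3) : ∃ C : ℝ≥0∞, C ≠ ∞ ∧ ∀ a b : ℂ, ‖a‖ < 1 → ‖b‖ < 1 →
      ∫⁻ u : ℂ × ℂ in thullenDomain α hα,
        (‖discMobiusDeriv a u.1 * thullenMapScale α a u.1‖ₑ *
          ‖discMobiusDeriv b (thullenMap α a u).2 * thullenAutScale α b (thullenMap α a u).2‖ₑ *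
          ENNReal.ofReal (thullenWeight α q (thullenAut α b (thullenMap α a u)))) ^ q ≤
        C * ENNReal.ofReal ((1 - ‖b‖ ^ 2) ^ (1 / 3 : ℝ) * (1 - ‖a‖ ^ 2)) := by
  -- `q < 4/3` is used twice: as `3q/2 < 2` here and as `q - 1/3 < 1` in the fibre integral.
  obtain ⟨C₁, hC₁, h₁⟩ :=
    exists_setLIntegral_ball_enorm_sub_rpow_neg_le (s := 3 / 2 * q) (by linarith)
  obtain ⟨C₂, hC₂, h₂⟩ := exists_setLIntegral_ball_one_sub_mul_rpow_le (s := 2 / 3)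
    (τ := q - 1 / 3) (by norm_num) (by norm_num) (by linarith) (by linarith)
  set κ : ℝ := min 1 (1 / α) ^ (1 - q) * max 1 (1 / α) ^ (1 - q / 2) * 2 ^ (2 - 3 / 2 * q) with hκ
  have hκ0 : 0 < κ := by positivity
  refine ⟨ENNReal.ofReal κ * (C₁ * C₂), ENNReal.mul_ne_top (by simp) (ENNReal.mul_ne_top hC₁ hC₂),
    fun a b ha hb => ?_⟩
  have hA := one_sub_norm_sq_pos ha
  have hB := Real.rpow_pos_of_pos (one_sub_norm_sq_pos hb) (1 / 3 : ℝ)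
  calc _ ≤ ∫⁻ u : ℂ × ℂ in thullenDomain α hα,
        ENNReal.ofReal (κ * ((1 - ‖b‖ ^ 2) ^ (1 / 3 : ℝ) * (1 - ‖a‖ ^ 2))) *
        (‖u.1 - a‖ₑ ^ (-(3 / 2 * q)) *
      ((ENNReal.ofReal (1 - ‖u.1‖ ^ (2 / α)))⁻¹ *
        (‖1 - conj b * (thullenMapScale α a u.1 * u.2)‖ₑ ^ (-(2 / 3 : ℝ)) *
          ENNReal.ofReal (1 - ‖u.2‖ ^ 2 / (1 - ‖u.1‖ ^ (2 / α))) ^ (-(q - 1 / 3))))) := by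
        refine setLIntegral_mono' (thullenDomain α hα).isOpen.measurableSet fun u hu => ?_
        have hu1 := norm_fst_lt_one_of_mem_thullenDomain hu
        have hv := (thullenMap_mem_iff hα ha hu1).2 hu
        have hv2 := norm_snd_lt_one_of_mem_thullenDomain hv
        have hρu := one_sub_norm_rpow_pos hα hu1
        have hY : 0 < 1 - ‖u.2‖ ^ 2 / (1 - ‖u.1‖ ^ (2 / α)) := by
          rw [sub_pos, div_lt_one hρu]
          have hu' := hu
          rw [SetLike.mem_coe, mem_thullenDomain] at hu'
          linarith
        have hN : 0 < ‖1 - conj b * (thullenMapScale α a u.1 * u.2)‖ := by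
          rw [thullenMap_eq] at hv2
          exact norm_pos_iff.2 (one_sub_conj_mul_ne_zero hb hv2)
        -- At `u₁ = a`, where `m = 0` and the logarithmic estimate is unavailable, the majorant is
        -- infinite.
        by_cases hua : u.1 = a
        · have h0 : ‖u.1 - a‖ₑ ^ (-(3 / 2 * q)) = ∞ := by
            rw [hua, sub_self, enorm_zero, ENNReal.zero_rpow_of_neg (by linarith)]
          rw [h0, ENNReal.top_mul, ENNReal.mul_top]
          · exact le_top
          · simpa using mul_pos hκ0 (mul_pos hB hA)
          · refine mul_ne_zero (by simp) (mul_ne_zero ?_ ?_)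
            · rw [← ofReal_norm, ENNReal.ofReal_rpow_of_pos hN]
              simpa using Real.rpow_pos_of_pos hN _
            · rw [ENNReal.ofReal_rpow_of_pos hY]
              simpa using Real.rpow_pos_of_pos hY _
        · have hd : 0 < ‖u.1 - a‖ := norm_pos_iff.2 (sub_ne_zero.2 hua)
          have key := norm_jacobian_mul_thullenWeight_rpow_le hq1 hq2.le ha hb hu hua
          rw [← hκ] at key
          have hw := thullenWeight_pos (q := q) ((thullenAut_mem_iff hα hb hv2).2 hv)
          rw [← ofReal_norm, ← ofReal_norm (_ * thullenAutScale _ _ _), ← ofReal_norm (u.1 - a),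
            ← ofReal_norm (1 - _), ENNReal.ofReal_rpow_of_pos hd, ENNReal.ofReal_rpow_of_pos hN,
            ENNReal.ofReal_rpow_of_pos hY, ← ENNReal.ofReal_inv_of_pos hρu,
            ← ENNReal.ofReal_mul (by positivity), ← ENNReal.ofReal_mul (by positivity),
            ← ENNReal.ofReal_mul (by positivity), ← ENNReal.ofReal_mul (by positivity),
            ← ENNReal.ofReal_mul (by positivity), ← ENNReal.ofReal_mul (by positivity),
            ENNReal.ofReal_rpow_of_nonneg (by positivity) (by linarith)]
          refine ENNReal.ofReal_le_ofReal (key.trans_eq ?_)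
          ring
    _ ≤ ENNReal.ofReal (κ * ((1 - ‖b‖ ^ 2) ^ (1 / 3 : ℝ) * (1 - ‖a‖ ^ 2))) * (C₁ * C₂) := by
        rw [lintegral_const_mul' _ _ (by simp)]
        gcongr
        exact lintegral_jacobian_majorant_le hα h₁ h₂ hC₂ ha hb
    _ = _ := by
        rw [ENNReal.ofReal_mul hκ0.le]
        ring

end Integrals

/-! ### Kernel norm against the weight -/

/-- The hypothesis gives `k ≤ K^(1/2) P^(-(1+α/2)) A^(-3/2)`. The total power of `P` is then the
same on both sides, `-(1+α/2) + 1/(3q)`, and the remaining `A^(-(3/2 - 1/q))` passes to `R` because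
`R ≤ cA`. -/
theorem norm_mul_rpow_le_weight {q α c K P A R k : ℝ} (hq : 1 ≤ q) (hc : 0 < c) (hK : 0 < K)
    (hP : 0 < P) (hA : 0 < A) (hR : 0 < R) (hk : 0 ≤ k)
    (h1 : k ^ 2 * (P ^ (2 + α) * A ^ 3) ≤ K) (h2 : R ≤ c * A) :
    k * (P ^ (1 / 3 : ℝ) * A) ^ (1 / q) ≤ K ^ (1 / 2 : ℝ) * c ^ (3 / 2 - 1 / q) *
      (P ^ (1 / 2 - α / 2 - 2 / (3 * q)) * (P * R) ^ (-(3 / 2 - 1 / q))) := by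
  rcases hk.eq_or_lt with rfl | hk
  · rw [zero_mul]
    positivity
  have hex : ∀ {x : ℝ}, 0 < x → ∃ y, Real.exp y = x := fun hx => ⟨_, Real.exp_log hx⟩
  rw [← Real.rpow_natCast, ← Real.rpow_natCast A] at h1
  obtain ⟨c, rfl⟩ := hex hc
  obtain ⟨K, rfl⟩ := hex hK
  obtain ⟨P, rfl⟩ := hex hP
  obtain ⟨A, rfl⟩ := hex hA
  obtain ⟨R, rfl⟩ := hex hR
  obtain ⟨k, rfl⟩ := hex hk
  simp only [← Real.exp_mul, ← Real.exp_add, Real.exp_le_exp] at h1 h2 ⊢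
  push_cast at h1
  have hi : 1 / q ≤ 1 := by rw [div_le_one (by positivity)]; exact hq
  have h3 := mul_le_mul_of_nonneg_left h2 (show 0 ≤ 3 / 2 - 1 / q by linarith)
  have e : 2 / (3 * q) = 2 / 3 * (1 / q) := by ring
  rw [e]
  generalize 1 / q = i at *
  nlinarith

open bergmanSpace in
theorem exists_enorm_kernel_mul_rpow_le {α : ℝ} (hα : 0 < α) {q : ℝ} (hq : 1 ≤ q) :
    ∃ C : ℝ≥0∞, C ≠ ∞ ∧ ∀ z : thullenDomain α hα, ‖kernel z‖ₑ *
      ENNReal.ofReal ((1 - ‖(z : ℂ × ℂ).2‖ ^ 2) ^ (1 / 3 : ℝ) *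
        (1 - ‖fAlpha α z‖ ^ 2)) ^ (1 / q) ≤ C * ENNReal.ofReal (thullenWeight α q z) := by
  refine ⟨ENNReal.ofReal ((64 / min 1 (1 / α)) ^ (1 / 2 : ℝ) *
    max 1 (1 / α) ^ (3 / 2 - 1 / q)), by simp, fun z => ?_⟩
  obtain ⟨z, hz⟩ := z
  have ha := norm_fAlpha_lt_one hz
  have hb := norm_snd_lt_one_of_mem_thullenDomain hz
  have hA := one_sub_norm_sq_pos ha
  have hB := one_sub_norm_sq_pos hb
  -- Transformation rule of the defining function under `φ_b`, evaluated at `(a, 0)`.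
  have hw : 1 - ‖z.1‖ ^ (2 / α) - ‖z.2‖ ^ 2 =
      (1 - ‖z.2‖ ^ 2) * (1 - ‖fAlpha α z‖ ^ (2 / α)) := by
    have := thullenAut_defining hα hb (w := (fAlpha α z, 0)) (by simp)
    rw [thullenAut_fAlpha hb] at this
    simpa using this
  have key := norm_mul_rpow_le_weight hq (α := α) (by positivity) (by positivity) hB hA
    (one_sub_norm_rpow_pos hα ha) (norm_nonneg _) (norm_kernel_sq_mul_le hα ⟨z, hz⟩)
    (one_sub_norm_rpow_le_max_mul hα ha)
  rw [← hw] at key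
  rw [← ofReal_norm, ENNReal.ofReal_rpow_of_nonneg (by positivity) (by positivity),
    ← ENNReal.ofReal_mul (by positivity), ← ENNReal.ofReal_mul (by positivity)]
  exact ENNReal.ofReal_le_ofReal key

theorem volume_thullenDomain_lt_top {α : ℝ} (hα : 0 < α) :
    volume (thullenDomain α hα : Set (ℂ × ℂ)) < ∞ := by
  refine (measure_mono ?_).trans_lt (measure_ball_lt_top (x := (0 : ℂ × ℂ)) (r := 1))
  intro w hw
  rw [mem_ball_zero_iff, Prod.norm_def]
  exact max_lt (norm_fst_lt_one_of_mem_thullenDomain hw) (norm_snd_lt_one_of_mem_thullenDomain hw)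

/-! ### Hölder's inequality after the change of variables -/

namespace bergmanSpace

theorem measurable_indicator_toFun {Ω : TopologicalSpace.Opens (ℂ × ℂ)} (f : bergmanSpace Ω) :
    Measurable ((Ω : Set (ℂ × ℂ)).indicator (toFun f)) := by
  classical
  rw [← Set.piecewise_eq_indicator]
  exact (differentiableOn_toFun f).continuousOn.measurable_piecewise continuousOn_const
    Ω.isOpen.measurableSet

variable {α : ℝ}

/-- Values of `toFun` off the domain are arbitrary; with the indicator inserted, the right side is
measurable on all of `ℂ²`. -/
theorem translV_translU_eq {hα : 0 < α} {a : ℂ} (ha : ‖a‖ < 1) {z : ℂ × ℂ} (hz : ‖z.2‖ < 1)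
    (g : bergmanSpace (thullenDomain α hα)) {u : ℂ × ℂ} (hu : u ∈ thullenDomain α hα) :
    translV α a (translU α z (toFun g)) u =
      (thullenDomain α hα : Set (ℂ × ℂ)).indicator (toFun g)
          (thullenAut α z.2 (thullenMap α a u)) *
        (discMobiusDeriv z.2 (thullenMap α a u).2 * thullenAutScale α z.2 (thullenMap α a u).2) *
        (discMobiusDeriv a u.1 * thullenMapScale α a u.1) := by
  have hu1 := norm_fst_lt_one_of_mem_thullenDomain hu
  have hv := (thullenMap_mem_iff hα ha hu1).2 hu
  have hv2 := norm_snd_lt_one_of_mem_thullenDomain hv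
  rw [Set.indicator_of_mem ((thullenAut_mem_iff hα hz hv2).2 hv), translV, translU,
    holJacobian_thullenMap ha hu1, holJacobian_thullenAut hz hv2]

theorem aemeasurable_translV_translU {hα : 0 < α} {a : ℂ} (ha : ‖a‖ < 1) {z : ℂ × ℂ}
    (hz : ‖z.2‖ < 1) (g : bergmanSpace (thullenDomain α hα)) :
    AEMeasurable (translV α a (translU α z (toFun g)))
      (volume.restrict (thullenDomain α hα : Set (ℂ × ℂ))) := by
  have h1 := measurable_indicator_toFun g
  have h2 := measurable_thullenAut α z.2
  have h3 := measurable_thullenMap α a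
  have h4 := measurable_thullenAutScale α z.2
  have h5 := measurable_thullenMapScale α a
  have h6 := measurable_discMobiusDeriv z.2
  have h7 := measurable_discMobiusDeriv a
  refine (Measurable.aemeasurable (f := fun u => _) ?_).congr
    ((ae_restrict_mem (thullenDomain α hα).isOpen.measurableSet).mono fun u hu =>
      (translV_translU_eq ha hz g hu).symm)
  exact ((h1.comp (h2.comp h3)).mul ((h6.comp h3.snd).mul (h4.comp h3.snd))).mul
    ((h7.comp measurable_fst).mul (h5.comp measurable_fst))

/-- Change of variables in a weighted `L¹` norm along the composition of `thullenMap α a` and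
`thullenAut α z.2`. -/
theorem lintegral_enorm_mul_eq_translV_translU (hα : 0 < α) {a : ℂ} (ha : ‖a‖ < 1) {z : ℂ × ℂ}
    (hz : ‖z.2‖ < 1) (g : bergmanSpace (thullenDomain α hα)) {h : ℂ × ℂ → ℝ≥0∞}
    (hh : Measurable h) :
    ∫⁻ w in thullenDomain α hα, ‖toFun g w‖ₑ * h w =
      ∫⁻ u in thullenDomain α hα, ‖translV α a (translU α z (toFun g)) u‖ₑ *
        (‖discMobiusDeriv a u.1 * thullenMapScale α a u.1‖ₑ *
          ‖discMobiusDeriv z.2 (thullenMap α a u).2 *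
            thullenAutScale α z.2 (thullenMap α a u).2‖ₑ *
          h (thullenAut α z.2 (thullenMap α a u))) := by
  have hm := (thullenDomain α hα).isOpen.measurableSet
  have h1 := measurable_indicator_toFun g
  have h2 := measurable_thullenAut α z.2
  have h4 := measurable_thullenAutScale α z.2
  have h6 := measurable_discMobiusDeriv z.2
  have e : ∫⁻ w in thullenDomain α hα, ‖toFun g w‖ₑ * h w = ∫⁻ w in thullenDomain α hα,
      ‖(thullenDomain α hα : Set (ℂ × ℂ)).indicator (toFun g) w‖ₑ * h w :=
    setLIntegral_congr_fun hm fun w hw => by rw [Set.indicator_of_mem hw]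
  rw [e, lintegral_thullenDomain_comp_thullenAut hα hz (by fun_prop),
    lintegral_thullenDomain_comp_thullenMap hα ha (by fun_prop)]
  refine setLIntegral_congr_fun hm fun u hu => ?_
  rw [translV_translU_eq ha hz g hu]
  simp only [enorm_mul]
  ring

theorem measurable_jacobian_mul_thullenWeight (α q : ℝ) (a b : ℂ) :
    Measurable fun u : ℂ × ℂ => ‖discMobiusDeriv a u.1 * thullenMapScale α a u.1‖ₑ *
      ‖discMobiusDeriv b (thullenMap α a u).2 * thullenAutScale α b (thullenMap α a u).2‖ₑ *
      ENNReal.ofReal (thullenWeight α q (thullenAut α b (thullenMap α a u))) := by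
  have m3 := measurable_thullenMap α a
  have m4 := measurable_thullenAutScale α b
  have m5 := measurable_thullenMapScale α a
  have m6 := measurable_discMobiusDeriv b
  have m7 := measurable_discMobiusDeriv a
  have m8 := (measurable_thullenWeight α q).comp ((measurable_thullenAut α b).comp m3)
  exact (((m7.comp measurable_fst).mul (m5.comp measurable_fst)).enorm.mul
    ((m6.comp m3.snd).mul (m4.comp m3.snd)).enorm).mul m8.ennreal_ofReal

/-- The Schur inequality with its constant proportional to the `L^p` norm of the translate of `g`:
Hölder separates that norm from the weighted Jacobian, and the kernel norm times the resulting power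
of `(1-|b|²)^(1/3)(1-|a|²)` is absorbed by the weight at `z`. -/
theorem exists_enorm_kernel_mul_lintegral_le (hα : 0 < α) {p q : ℝ} (hpq : p.HolderConjugate q)
    (hq : q < 4 / 3) : ∃ C : ℝ≥0∞, C ≠ ∞ ∧
      ∀ (z : thullenDomain α hα) (g : bergmanSpace (thullenDomain α hα)),
        ‖kernel z‖ₑ * ∫⁻ w in thullenDomain α hα,
            ‖toFun g w‖ₑ * ENNReal.ofReal (thullenWeight α q w) ≤
          C * eLpNorm (translV α (fAlpha α z) (translU α z (toFun g))) (ENNReal.ofReal p)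
            (volume.restrict (thullenDomain α hα : Set (ℂ × ℂ))) *
            ENNReal.ofReal (thullenWeight α q z) := by
  have hq1 : 1 ≤ q := hpq.symm.lt.le
  obtain ⟨C₁, hC₁, h₁⟩ := exists_lintegral_jacobian_mul_thullenWeight_rpow_le hα hq1 hq
  obtain ⟨C₂, hC₂, h₂⟩ := exists_enorm_kernel_mul_rpow_le hα hq1
  refine ⟨C₁ ^ (1 / q) * C₂, ENNReal.mul_ne_top (ENNReal.rpow_ne_top_of_nonneg (by positivity) hC₁)
    hC₂, fun z g => ?_⟩
  have ha := norm_fAlpha_lt_one z.2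
  have hb := norm_snd_lt_one_of_mem_thullenDomain z.2
  have hw := measurable_thullenWeight α q
  rw [lintegral_enorm_mul_eq_translV_translU hα ha hb g (by fun_prop)]
  set a := fAlpha α z
  set b := (z : ℂ × ℂ).2
  have hH := ENNReal.lintegral_mul_le_Lp_mul_Lq
    (volume.restrict (thullenDomain α hα : Set (ℂ × ℂ))) hpq
    (aemeasurable_translV_translU (hα := hα) ha hb g).enorm
    (measurable_jacobian_mul_thullenWeight α q a b).aemeasurable
  have hN : (∫⁻ u in thullenDomain α hα,
      ‖translV α a (translU α z (toFun g)) u‖ₑ ^ p) ^ (1 / p) =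
      eLpNorm (translV α a (translU α z (toFun g))) (ENNReal.ofReal p)
        (volume.restrict (thullenDomain α hα : Set (ℂ × ℂ))) := by
    rw [eLpNorm_eq_lintegral_rpow_enorm_toReal (by simpa using hpq.pos) (by simp),
      ENNReal.toReal_ofReal hpq.pos.le]
  rw [hN] at hH
  set N := eLpNorm (translV α a (translU α z (toFun g))) (ENNReal.ofReal p)
    (volume.restrict (thullenDomain α hα : Set (ℂ × ℂ)))
  set X := ENNReal.ofReal ((1 - ‖b‖ ^ 2) ^ (1 / 3 : ℝ) * (1 - ‖a‖ ^ 2))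
  calc _ ≤ ‖kernel z‖ₑ * (N * (C₁ * X) ^ (1 / q)) := by
        gcongr
        refine hH.trans ?_
        gcongr
        exact h₁ a b ha hb
    _ = C₁ ^ (1 / q) * N * (‖kernel z‖ₑ * X ^ (1 / q)) := by
        rw [ENNReal.mul_rpow_of_nonneg _ _ (by positivity)]
        ring
    _ ≤ C₁ ^ (1 / q) * N * (C₂ * ENNReal.ofReal (thullenWeight α q z)) := by
        exact mul_le_mul_right (h₂ z) _
    _ = _ := by ring

end bergmanSpace

/-! ### Conclusion -/

theorem theorem3p1 (α : ℝ) (hα : 0 < α) (hα1 : α ≠ 1)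
    (T Tstar : bergmanSpace.kernelSpan (thullenDomain α hα) →ₗ[ℂ]
      bergmanSpace (thullenDomain α hα))
    (hdual : ∀ z w : thullenDomain α hα,
      inner ℂ (bergmanSpace.normalizedKernel w) (T (bergmanSpace.spanKernel z)) =
        inner ℂ (Tstar (bergmanSpace.spanKernel w)) (bergmanSpace.normalizedKernel z))
    (p : ENNReal) (hp : 4 < p)
    (hT : (⨆ z : thullenDomain α hα,
      MeasureTheory.eLpNorm
        (translV α (fAlpha α z)
          (translU α z (bergmanSpace.toFun (T (bergmanSpace.spanKernel z)))))
        p (MeasureTheory.volume.restrict (thullenDomain α hα : Set (ℂ × ℂ)))) < ⊤)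
    (hTstar : (⨆ z : thullenDomain α hα,
      MeasureTheory.eLpNorm
        (translV α (fAlpha α z)
          (translU α z (bergmanSpace.toFun (Tstar (bergmanSpace.spanKernel z)))))
        p (MeasureTheory.volume.restrict (thullenDomain α hα : Set (ℂ × ℂ)))) < ⊤) :
    ∃ S : bergmanSpace (thullenDomain α hα) →L[ℂ] bergmanSpace (thullenDomain α hα),
      ∀ f : bergmanSpace.kernelSpan (thullenDomain α hα), S f = T f := by
  -- A finite exponent `r > 4` suffices, since the domain has finite volume and the `L^r` norm is
  -- controlled by the `L^p` norm; this also covers `p = ∞`.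
  obtain ⟨r, hr4, hrp⟩ : ∃ r : ℝ, 4 < r ∧ ENNReal.ofReal r ≤ p := by
    obtain ⟨r, h1, h2⟩ := ENNReal.lt_iff_exists_nnreal_btwn.1 hp
    exact ⟨r, by exact_mod_cast h1, by simpa using h2.le⟩
  have hpq : r.HolderConjugate r.conjExponent := .conjExponent (by linarith)
  have hq : r.conjExponent < 4 / 3 := by
    rw [Real.conjExponent, div_lt_div_iff₀ (by linarith) (by norm_num)]
    linarith
  obtain ⟨C, hC, h⟩ := bergmanSpace.exists_enorm_kernel_mul_lintegral_le hα hpq hq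
  set V := volume (thullenDomain α hα : Set (ℂ × ℂ)) ^
    (1 / (ENNReal.ofReal r).toReal - 1 / p.toReal)
  have hV : V ≠ ∞ := by
    refine ENNReal.rpow_ne_top_of_nonneg ?_ (volume_thullenDomain_lt_top hα).ne
    rw [ENNReal.toReal_ofReal (by linarith), sub_nonneg]
    rcases eq_or_ne p ∞ with rfl | hpt
    · simp only [ENNReal.toReal_top, div_zero]
      positivity
    · exact one_div_le_one_div_of_le (by linarith)
        ((ENNReal.ofReal_le_iff_le_toReal hpt).1 hrp)
  have hbound : ∀ {R : bergmanSpace.kernelSpan (thullenDomain α hα) →ₗ[ℂ]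
      bergmanSpace (thullenDomain α hα)} {M : ℝ≥0∞},
      (⨆ z : thullenDomain α hα, eLpNorm (translV α (fAlpha α z)
          (translU α z (bergmanSpace.toFun (R (bergmanSpace.spanKernel z)))))
        p (volume.restrict (thullenDomain α hα : Set (ℂ × ℂ)))) ≤ M → ∀ z : thullenDomain α hα,
      ‖bergmanSpace.kernel z‖ₑ * ∫⁻ w in thullenDomain α hα,
        ‖bergmanSpace.toFun (R (bergmanSpace.spanKernel z)) w‖ₑ *
          ENNReal.ofReal (thullenWeight α r.conjExponent w) ≤
      C * (M * V) * ENNReal.ofReal (thullenWeight α r.conjExponent z) := by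
    intro R M hM z
    refine (h z _).trans ?_
    gcongr
    have := eLpNorm_le_eLpNorm_mul_rpow_measure_univ
      (μ := volume.restrict (thullenDomain α hα : Set (ℂ × ℂ))) hrp
      (bergmanSpace.aemeasurable_translV_translU (norm_fAlpha_lt_one z.2)
        (norm_snd_lt_one_of_mem_thullenDomain z.2)
        (R (bergmanSpace.spanKernel z))).aestronglyMeasurable
    rw [Measure.restrict_apply_univ] at this
    refine this.trans ?_
    gcongr
    exact (le_iSup_iff.2 fun _ hb => hb z).trans hM
  set M := max (⨆ z : thullenDomain α hα, eLpNorm (translV α (fAlpha α z)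
      (translU α z (bergmanSpace.toFun (T (bergmanSpace.spanKernel z)))))
      p (volume.restrict (thullenDomain α hα : Set (ℂ × ℂ))))
    (⨆ z : thullenDomain α hα, eLpNorm (translV α (fAlpha α z)
      (translU α z (bergmanSpace.toFun (Tstar (bergmanSpace.spanKernel z)))))
      p (volume.restrict (thullenDomain α hα : Set (ℂ × ℂ))))
  have hM : M ≠ ∞ := (max_lt hT hTstar).ne
  have hw := measurable_thullenWeight α r.conjExponent
  exact bergmanSpace.exists_clm_extending_of_schur T Tstar hdual
    (h := fun w => ENNReal.ofReal (thullenWeight α r.conjExponent w)) (by fun_prop)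
    (fun z hz => by simpa using thullenWeight_pos hz) (fun _ _ => ENNReal.ofReal_ne_top)
    (C := C * (M * V)) (ENNReal.mul_ne_top hC (ENNReal.mul_ne_top hM hV))
    (hbound (le_max_left _ _)) (hbound (le_max_right _ _))
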